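/- **Setting.** Let $n\ge 2$ and let $L$ be the Laplacian of a connected undirected weighted graph on $\{1,\dots,n\}$ (nonnegative symmetric weights, no loops), with eigenvalues $0=\lambda_1<\lambda_2\le\dots\le\lambda_n$. Let $J,\beta,\tau>0$, $\eta\ge 0$, $d=\beta/J$. Let $M,K$ be gain matrices such that, for one orthogonal matrix $Q=(q_{il})$, $Q^TLQ=\mathrm{diag}(\lambda_l)$, $Q^TMQ=\mathrm{diag}(\mu_l)$, $Q^TKQ=\mathrm{diag}(\kappa_l)$. Consider the noisy delayed network (with noiseless measurements, $\eta'=0$) $$d\theta_t=\omega_t\,dt,\qquad d\omega_t=\big(-L\theta_t-d\,\omega_t-M\theta_{t-\tau}-K\omega_{t-\tau}\big)dt+\tfrac{\eta}{J}\,d\xi_t ,$$ where $\xi$ is an $n$-dimensional standard Brownian motion and the initial data on $[-\tau,0]$ are fixed continuous functions. **Spectral function.** For $s=(s_1,s_2)\in\mathbb R_+^2$, $k=(k_1,k_2)\in\mathbb R^2$ put $$f(s;k)=\int_{\mathbb R}\frac{dr}{\big|-r^2+\mathrm i s_1r+s_2+(k_1+\mathrm i k_2r)e^{-\mathrm i r}\big|^2}\in(0,\infty].$$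 Written out, the denominator is $2((s_1k_2-k_1)r^2+s_2k_1)\cos r-2r(k_2r^2+s_1k_1-k_2s_2)\sin r+r^4+(s_1^2+k_2^2-2s_2)r^2+s_2^2+k_1^2$. **Stability region.** Let $\Delta=k_2^2+2s_2-s_1^2$ and let $\gamma_\pm\ge0$ satisfy $\gamma_\pm^2=\frac12\big(\Delta\pm\sqrt{\Delta^2-4(s_2^2-k_1^2)}\big)$; let $\varphi_\pm\in[0,2\pi)$ be the angles with $$\cos\varphi_\pm=-\frac{s_1k_2\gamma_\pm^2+k_1(s_2-\gamma_\pm^2)}{k_2^2\gamma_\pm^2+k_1^2},\qquad \sin\varphi_\pm=\frac{s_1k_1\gamma_\pm-k_2\gamma_\pm(s_2-\gamma_\pm^2)}{k_2^2\gamma_\pm^2+k_1^2}.$$ Let $\mathbb W=\mathbb W_1\cup\mathbb W_2\cup\mathbb W_3$ be the set of $(s;k)\in\mathbb R_+^2\times\mathbb R^2$ with $k_2+s_1>0$, $k_1+s_2>0$ and one of: - ($\mathbb W_1$) $s_2^2>k_1^2$ and $\Delta\le2\sqrt{s_2^2-k_1^2}$; - ($\mathbb W_2$) $s_2^2\le k_1^2$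 and $\gamma_+<\varphi_+$; - ($\mathbb W_3$) $s_2^2>k_1^2$, $\Delta>2\sqrt{s_2^2-k_1^2}$, and either $\gamma_+<\varphi_+$ or, for some integer $l\ge1$, $\gamma_->\varphi_-+2(l-1)\pi$ and $\gamma_+<\varphi_++2l\pi$. For $l\ge2$ put $\underline f_l=\inf\{f(s_l;k):(s_l;k)\in\mathbb W\}$ with $s_l=(d\tau,\lambda_l\tau^2)$, and $$\sigma_*=\frac{\tau^{3/2}\eta}{J\sqrt{2\pi}}\,\min_{i\ne j}\sqrt{\sum_{l=2}^n(q_{il}-q_{jl})^2\,\underline f_l}.$$ **Proposition.** $0<\underline f_l<\infty$ for $l=2,\dots,n$; $\sigma_*$ is finite, it is positive if $\eta>0$, and it may be computed from any orthogonal eigenbasis of $L$ (so it does not depend on the gains). For all gains $M,K$ as above with $(d\tau,\lambda_l\tau^2;\mu_l\tau^2,\kappa_l\tau)\in\mathbb W$ for $l=2,\dots,n$, and all $i\neq j$, $$\sigma_{ij}\ \ge\ \sigma_* .$$ This holds for $$\sigma_{ij}=\frac{\tau^{3/2}\eta}{J\sqrt{2\pi}}\sqrt{\sum_{l=2}^n(q_{il}-q_{jl})^2\,f(d\tau,\lambda_l\tau^2;\mu_l\tau^2,\kappa_l\tau)}\in[0,\infty]$$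 and also for the steady-state standard deviation of the phase difference, i.e. $\liminf_{t\to\infty}\mathrm{Var}\big(\theta^{(i)}_t-\theta^{(j)}_t\big)\ge\sigma_*^2$ for every solution of the network equation. -/

import Mathlib

open MeasureTheory ProbabilityTheory Filter Matrix
open scoped ENNReal NNReal Topology

noncomputable section

namespace PowerRisk

/-! ### The stability region in the dimensionless parameters `(s₁, s₂; k₁, k₂)` -/

/-- `Δ = k₂² + 2 s₂ - s₁²`. -/
def discr (s₁ s₂ _k₁ k₂ : ℝ) : ℝ := k₂ ^ 2 + 2 * s₂ - s₁ ^ 2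

/-- `γ₊`, the nonnegative root of `γ₊² = (Δ + √(Δ² - 4 (s₂² - k₁²))) / 2`. -/
def gammaPlus (s₁ s₂ k₁ k₂ : ℝ) : ℝ :=
  √((discr s₁ s₂ k₁ k₂ + √(discr s₁ s₂ k₁ k₂ ^ 2 - 4 * (s₂ ^ 2 - k₁ ^ 2))) / 2)

/-- `γ₋`, the nonnegative root of `γ₋² = (Δ - √(Δ² - 4 (s₂² - k₁²))) / 2`. -/
def gammaMinus (s₁ s₂ k₁ k₂ : ℝ) : ℝ :=
  √((discr s₁ s₂ k₁ k₂ - √(discr s₁ s₂ k₁ k₂ ^ 2 - 4 * (s₂ ^ 2 - k₁ ^ 2))) / 2)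

/-- `φ ∈ [0, 2π)` is the angle attached to the frequency `γ`. For `γ = γ₊` or `γ = γ₋` the two
right-hand sides are the cosine and sine of a unique such angle. -/
def IsAngle (s₁ s₂ k₁ k₂ γ φ : ℝ) : Prop :=
  φ ∈ Set.Ico 0 (2 * Real.pi) ∧
  Real.cos φ = -(s₁ * k₂ * γ ^ 2 + k₁ * (s₂ - γ ^ 2)) / (k₂ ^ 2 * γ ^ 2 + k₁ ^ 2) ∧
  Real.sin φ = (s₁ * k₁ * γ - k₂ * γ * (s₂ - γ ^ 2)) / (k₂ ^ 2 * γ ^ 2 + k₁ ^ 2)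

/-- The delay-window condition: the dimensionless delay `1` lies before the first critical delay
`φ₊ / γ₊`, or strictly between `(φ₋ + 2(l-1)π) / γ₋` and `(φ₊ + 2lπ) / γ₊` for some `l ≥ 1`.
The index `l` needs no upper cut-off `l*`: see `le_of_window`. -/
def Window (γp φp γm φm : ℝ) : Prop :=
  γp < φp ∨ ∃ l : ℕ, 1 ≤ l ∧
    φm + 2 * ((l : ℝ) - 1) * Real.pi < γm ∧ γp < φp + 2 * (l : ℝ) * Real.pi

/-- The windows with index beyond the cut-off `l*` are empty. -/
theorem le_of_window {γp φp γm φm : ℝ} (hm : 0 < γm) (hmp : γm < γp) {l lstar : ℕ}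
    (h₁ : φm + 2 * ((l : ℝ) - 1) * Real.pi < γm) (h₂ : γp < φp + 2 * (l : ℝ) * Real.pi)
    (hl : (γm * (φp + 2 * Real.pi) - φm * γp) / (2 * Real.pi * (γp - γm)) < lstar) :
    l ≤ lstar := by
  have hpos : 0 < 2 * Real.pi * (γp - γm) := mul_pos Real.two_pi_pos (sub_pos.2 hmp)
  rw [div_lt_iff₀ hpos] at hl
  have e₁ := mul_lt_mul_of_pos_left h₁ (hm.trans hmp)
  have e₂ := mul_lt_mul_of_pos_left h₂ hm
  have e₃ : (l : ℝ) * (2 * Real.pi * (γp - γm)) < (lstar + 1) * (2 * Real.pi * (γp - γm)) := by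
    linarith
  have e₄ : (l : ℝ) < lstar + 1 := lt_of_mul_lt_mul_right e₃ hpos.le
  exact Nat.lt_succ_iff.1 (by exact_mod_cast e₄)

def W₁ (s₁ s₂ k₁ k₂ : ℝ) : Prop :=
  0 ≤ s₁ ∧ 0 ≤ s₂ ∧ k₁ ^ 2 < s₂ ^ 2 ∧ 0 < k₂ + s₁ ∧ 0 < k₁ + s₂ ∧
    k₂ ^ 2 + 2 * s₂ - s₁ ^ 2 ≤ 2 * √(s₂ ^ 2 - k₁ ^ 2)

def W₂ (s₁ s₂ k₁ k₂ : ℝ) : Prop :=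
  0 ≤ s₁ ∧ 0 ≤ s₂ ∧ s₂ ^ 2 ≤ k₁ ^ 2 ∧ 0 < k₂ + s₁ ∧ 0 < k₁ + s₂ ∧
    ∃ φ, IsAngle s₁ s₂ k₁ k₂ (gammaPlus s₁ s₂ k₁ k₂) φ ∧ gammaPlus s₁ s₂ k₁ k₂ < φ

def W₃ (s₁ s₂ k₁ k₂ : ℝ) : Prop :=
  0 ≤ s₁ ∧ 0 ≤ s₂ ∧ k₁ ^ 2 < s₂ ^ 2 ∧ 0 < k₂ + s₁ ∧ 0 < k₁ + s₂ ∧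
    2 * √(s₂ ^ 2 - k₁ ^ 2) < k₂ ^ 2 + 2 * s₂ - s₁ ^ 2 ∧
    ∃ φp φm, IsAngle s₁ s₂ k₁ k₂ (gammaPlus s₁ s₂ k₁ k₂) φp ∧
      IsAngle s₁ s₂ k₁ k₂ (gammaMinus s₁ s₂ k₁ k₂) φm ∧
      Window (gammaPlus s₁ s₂ k₁ k₂) φp (gammaMinus s₁ s₂ k₁ k₂) φm

/-- The stability region `𝕎₁ ∪ 𝕎₂ ∪ 𝕎₃`. -/
def InRegion (s₁ s₂ k₁ k₂ : ℝ) : Prop :=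
  W₁ s₁ s₂ k₁ k₂ ∨ W₂ s₁ s₂ k₁ k₂ ∨ W₃ s₁ s₂ k₁ k₂

/-! ### The spectral function -/

/-- The denominator of the spectral function. -/
def specDenom (s₁ s₂ k₁ k₂ r : ℝ) : ℝ :=
  2 * ((s₁ * k₂ - k₁) * r ^ 2 + s₂ * k₁) * Real.cos r
    - 2 * r * (k₂ * r ^ 2 + s₁ * k₁ - k₂ * s₂) * Real.sin r
    + r ^ 4 + (s₁ ^ 2 + k₂ ^ 2 - 2 * s₂) * r ^ 2 + s₂ ^ 2 + k₁ ^ 2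

/-- The spectral function `f(s; k)`, with value `∞` where the (nonnegative) integrand is not
integrable. -/
def specFun (s₁ s₂ k₁ k₂ : ℝ) : ℝ≥0∞ :=
  ∫⁻ r : ℝ, (ENNReal.ofReal (specDenom s₁ s₂ k₁ k₂ r))⁻¹

/-- The least value (infimum) of the spectral function over all `k` in the stability region. -/
def specInf (s₁ s₂ : ℝ) : ℝ≥0∞ :=
  ⨅ k : ℝ × ℝ, ⨅ _ : InRegion s₁ s₂ k.1 k.2, specFun s₁ s₂ k.1 k.2

/-! ### The power network -/

/-- A linearized network of `n` generators with equal inertia and damping, coupled through a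
connected weighted undirected graph, with feedback delay and load-noise intensity. -/
structure PowerNetwork (n : ℕ) where
  weight : Matrix (Fin n) (Fin n) ℝ
  weight_symm : ∀ i j, weight i j = weight j i
  weight_nonneg : ∀ i j, 0 ≤ weight i j
  weight_self : ∀ i, weight i i = 0
  connected : (SimpleGraph.fromRel fun i j => 0 < weight i j).Connected
  /-- inertia `J` -/
  J : ℝ
  J_pos : 0 < J
  /-- damping coefficient `β` -/
  β : ℝ
  β_pos : 0 < β
  /-- time-delay `τ` -/
  τ : ℝ
  τ_pos : 0 < τ
  /-- load-noise intensity `η` -/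
  η : ℝ
  η_nonneg : 0 ≤ η

namespace PowerNetwork

variable {n : ℕ}

/-- The weighted graph Laplacian. -/
def L (N : PowerNetwork n) : Matrix (Fin n) (Fin n) ℝ :=
  Matrix.diagonal (fun i => ∑ j, N.weight i j) - N.weight

/-- The damping ratio `d = β / J`. -/
def d (N : PowerNetwork n) : ℝ := N.β / N.J

/-- The noisy closed-loop network with feedback gains `M`, `K` and measurement-noise intensity `η'`:
`dθ = ω dt`,
`dω = (-L θ_t - d ω_t - M θ_{t-τ} - K ω_{t-τ}) dt + (η/J) dξ⁰ + η' M dξ¹ + η' K dξ²`,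
with `3n` independent Brownian motions and deterministic continuous initial data on `[-τ, 0]`.
As the noise is additive, the equation is understood pathwise in integrated form. -/
structure IsSolution (N : PowerNetwork n) (M K : Matrix (Fin n) (Fin n) ℝ) (η' : ℝ)
    {Ω : Type*} [MeasurableSpace Ω] (P : Measure Ω)
    (ξ : Fin 3 → Fin n → ℝ≥0 → Ω → ℝ) (θ₀ ω₀ : ℝ → Fin n → ℝ)
    (θ ω : ℝ → Ω → Fin n → ℝ) : Prop where
  brownian : ∀ a i, IsBrownianReal (ξ a i) P
  indep : iIndepFun (fun (p : Fin 3 × Fin n) x (t : ℝ≥0) => ξ p.1 p.2 t x) P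
  init_cont_phase : ContinuousOn θ₀ (Set.Icc (-N.τ) 0)
  init_cont_freq : ContinuousOn ω₀ (Set.Icc (-N.τ) 0)
  measurable_phase : ∀ t, -N.τ ≤ t → AEMeasurable (θ t) P
  measurable_freq : ∀ t, -N.τ ≤ t → AEMeasurable (ω t) P
  path_cont : ∀ᵐ x ∂P, ContinuousOn (fun t => θ t x) (Set.Ici (-N.τ)) ∧
    ContinuousOn (fun t => ω t x) (Set.Ici (-N.τ))
  init : ∀ᵐ x ∂P, ∀ t ∈ Set.Icc (-N.τ) 0, θ t x = θ₀ t ∧ ω t x = ω₀ t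
  phase_eq : ∀ᵐ x ∂P, ∀ t, 0 ≤ t → ∀ i, θ t x i = θ₀ 0 i + ∫ s in (0 : ℝ)..t, ω s x i
  freq_eq : ∀ᵐ x ∂P, ∀ t, 0 ≤ t → ∀ i, ω t x i = ω₀ 0 i +
    (∫ s in (0 : ℝ)..t, (-(N.L *ᵥ θ s x) i - N.d * ω s x i
      - (M *ᵥ θ (s - N.τ) x) i - (K *ᵥ ω (s - N.τ) x) i)) +
    (N.η / N.J * ξ 0 i t.toNNReal x + η' * (M *ᵥ fun j => ξ 1 j t.toNNReal x) i
      + η' * (K *ᵥ fun j => ξ 2 j t.toNNReal x) i)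

end PowerNetwork

/-- The steady-state standard deviation of the phase difference of generators `i` and `j`, in
`[0, ∞]`: the square root of the limit (lower limit) of `Var(θⁱ_t - θʲ_t)` as `t → ∞`. -/
def steadyStd {n : ℕ} {Ω : Type*} [MeasurableSpace Ω] (P : Measure Ω)
    (θ : ℝ → Ω → Fin n → ℝ) (i j : Fin n) : ℝ≥0∞ :=
  (liminf (fun t : ℝ => evariance (fun x => θ t x i - θ t x j) P) atTop) ^ (1 / 2 : ℝ)

/-- `A = Q diag(a) Qᵀ` with `Q` orthogonal. -/
def DiagonalizedBy {n : ℕ} (A Q : Matrix (Fin n) (Fin n) ℝ) (a : Fin n → ℝ) : Prop :=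
  Q ∈ Matrix.orthogonalGroup (Fin n) ℝ ∧ A = Q * Matrix.diagonal a * Qᵀ

namespace PowerNetwork

variable {n : ℕ}

/-- The weight `𝔣_l` of a mode with Laplacian eigenvalue `lam` and gain eigenvalues `mu`, `kap`. -/
def modeWeight (N : PowerNetwork n) (η' lam mu kap : ℝ) : ℝ≥0∞ :=
  ENNReal.ofReal (N.τ ^ 3 * (N.η ^ 2 / N.J ^ 2 +
      η' ^ 2 * ((mu * N.τ ^ 2) ^ 2 / N.τ ^ 4 + (kap * N.τ) ^ 2 / N.τ ^ 2))) *
    specFun (N.d * N.τ) (lam * N.τ ^ 2) (mu * N.τ ^ 2) (kap * N.τ)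

/-- `σ_ij = √((1/2π) ∑_{l ≥ 2} (q_il - q_jl)² 𝔣_l)`. Modes are indexed by `Fin n`, so the first
mode is `0`. -/
def sigma (N : PowerNetwork n) (η' : ℝ) (Q : Matrix (Fin n) (Fin n) ℝ) (lam mu kap : Fin n → ℝ)
    (i j : Fin n) : ℝ≥0∞ :=
  (ENNReal.ofReal (1 / (2 * Real.pi)) * ∑ l : Fin n with l.val ≠ 0,
    ENNReal.ofReal ((Q i l - Q j l) ^ 2) * N.modeWeight η' (lam l) (mu l) (kap l)) ^ (1 / 2 : ℝ)

/-- The delay-induced limit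
`σ_* = τ^{3/2} η / (J √(2π)) · min_{i ≠ j} √(∑_{l ≥ 2} (q_il - q_jl)² f̲_l)`. -/
def sigmaStar (N : PowerNetwork n) (Q : Matrix (Fin n) (Fin n) ℝ) (lam : Fin n → ℝ) : ℝ≥0∞ :=
  ENNReal.ofReal (N.τ ^ (3 / 2 : ℝ) * N.η / (N.J * √(2 * Real.pi))) *
    ⨅ p : {p : Fin n × Fin n // p.1 ≠ p.2},
      (∑ l : Fin n with l.val ≠ 0, ENNReal.ofReal ((Q p.1.1 l - Q p.1.2 l) ^ 2) *
        specInf (N.d * N.τ) (lam l * N.τ ^ 2)) ^ (1 / 2 : ℝ)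

end PowerNetwork

end PowerRisk

end

namespace PowerRisk

/-! ### Bounds on the stability region and on the spectral function -/

/-! The limit is positive because stabilizing gains are bounded. In each piece of the region the
critical frequencies are controlled by angles below 2π, and this bounds `k₁` and `k₂` in terms of
`s` (`InRegion.sq_gain_le`). The spectral denominator is then uniformly bounded on `[0, 1]`, so
`specInf` is positive. It is finite because zero gain lies in `W₁` and has a convergent integral.

The variance is computed mode by mode. In the eigenbasis each coordinate solves a scalar delay
equation, which double integration turns into a Volterra equation `x + k ∗ x = …`. With `Ψ + k ∗ Ψ =
1` and `Φ` the primitive of `Ψ`, the coordinate equals a deterministic function plus `(η/J) ∫ Ψ(t -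
s) ξ_s ds` (`exists_delay_representation`). The noise enters through its path, so no stochastic
integral is needed. The covariance `min s u` gives this integral the variance `∫₀ᵗ Φ²`, and distinct
modes are uncorrelated (`memLp_and_variance_modal_integral`). Hence the variance of a phase
difference tends to `(η/J)² ∑ (q_il - q_jl)² ∫₀^∞ Φ_l²`, possibly infinite.

The Laplace transform of `Φ` is the inverse of the characteristic function. Plancherel's theorem for
`exp(-εt) Φ` and Fatou's lemma as `ε → 0` bound `∫ Φ²` below by the spectral function
(`specFun_le_energy`). Only this inequality is needed, and it is trivial when `∫ Φ²` diverges, so no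
stability analysis enters: the region matters only for comparing `specFun` with `specInf`.

Finally, `∑ (q_il - q_jl)² φ(λ_l)` is a quadratic form of `φ(L)`, hence independent of the
eigenbasis. It is positive for `i ≠ j` because the rows of `Q` differ and, the graph being
connected, the constant first column does not separate them. -/

theorem InRegion.sq_gain_le {s₁ s₂ k₁ k₂ : ℝ} (h : InRegion s₁ s₂ k₁ k₂) :
    k₁ ^ 2 ≤ s₂ ^ 2 + (4 * Real.pi ^ 2) ^ 2 + s₁ ^ 2 * (4 * Real.pi ^ 2) ∧
      k₂ ^ 2 ≤ s₁ ^ 2 + 16 * Real.pi ^ 2 + 2 * s₂ := by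
  have hpi := Real.pi_pos
  have hpi2 : 0 < Real.pi ^ 2 := by positivity
  rcases h with h | h | h
  · obtain ⟨h1, h2, h3, -, -, h4⟩ := h
    have : √(s₂ ^ 2 - k₁ ^ 2) ≤ s₂ :=
      (Real.sqrt_le_sqrt (by nlinarith [sq_nonneg k₁])).trans_eq (Real.sqrt_sq h2)
    constructor
    · have : 0 ≤ (4 * Real.pi ^ 2) ^ 2 + s₁ ^ 2 * (4 * Real.pi ^ 2) := by positivity
      linarith
    · linarith
  · obtain ⟨h1, h2, h3, -, -, φ, ⟨⟨hφ0, hφ⟩, -, -⟩, hγ⟩ := h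
    set D := discr s₁ s₂ k₁ k₂ with hD
    have hDe : D = k₂ ^ 2 + 2 * s₂ - s₁ ^ 2 := rfl
    set R := √(D ^ 2 - 4 * (s₂ ^ 2 - k₁ ^ 2)) with hR
    have hRD : |D| ≤ R := by
      rw [← Real.sqrt_sq_eq_abs]
      exact Real.sqrt_le_sqrt (by linarith)
    have hR2 : R ^ 2 = D ^ 2 - 4 * (s₂ ^ 2 - k₁ ^ 2) :=
      Real.sq_sqrt (by nlinarith [sq_nonneg D])
    have hg : gammaPlus s₁ s₂ k₁ k₂ ^ 2 = (D + R) / 2 :=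
      Real.sq_sqrt (by linarith [neg_abs_le D])
    have hg0 : 0 ≤ gammaPlus s₁ s₂ k₁ k₂ := Real.sqrt_nonneg _
    have hlt : (D + R) / 2 ≤ 4 * Real.pi ^ 2 := by
      rw [← hg]
      nlinarith
    -- `x = γ₊²` is the larger root of `x² - D x + s₂² - k₁² = 0`. The bound `γ₊ < φ < 2π` on the
    -- root therefore bounds the coefficients.
    set x := (D + R) / 2 with hx
    have hx0 : 0 ≤ x := hg ▸ sq_nonneg _
    have hxe : k₁ ^ 2 - s₂ ^ 2 = x ^ 2 - D * x := by
      rw [hx]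
      linarith
    have hDx : D ≤ x := by linarith [le_abs_self D]
    constructor
    · have e1 : -D * x ≤ s₁ ^ 2 * x :=
        mul_le_mul_of_nonneg_right (by nlinarith [sq_nonneg k₂]) hx0
      have e2 : s₁ ^ 2 * x ≤ s₁ ^ 2 * (4 * Real.pi ^ 2) :=
        mul_le_mul_of_nonneg_left hlt (sq_nonneg _)
      have e3 : x ^ 2 ≤ (4 * Real.pi ^ 2) ^ 2 := pow_le_pow_left₀ hx0 hlt 2
      linarith
    · linarith
  · obtain ⟨h1, h2, h3, -, -, h4, φp, φm, ⟨⟨hp0, hp⟩, -, -⟩, ⟨⟨hm0, hm⟩, -, -⟩, hw⟩ := h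
    have hS : √(s₂ ^ 2 - k₁ ^ 2) ≤ s₂ :=
      (Real.sqrt_le_sqrt (by nlinarith [sq_nonneg k₁])).trans_eq (Real.sqrt_sq h2)
    set S := √(s₂ ^ 2 - k₁ ^ 2) with hSdef
    have hS0 : 0 ≤ S := Real.sqrt_nonneg _
    have hS2 : S ^ 2 = s₂ ^ 2 - k₁ ^ 2 := Real.sq_sqrt (by linarith)
    set D := discr s₁ s₂ k₁ k₂ with hD
    have hDe : D = k₂ ^ 2 + 2 * s₂ - s₁ ^ 2 := rfl
    rw [← hDe] at h4
    have hD0 : 0 < D := by linarith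
    set R := √(D ^ 2 - 4 * (s₂ ^ 2 - k₁ ^ 2)) with hR
    have hR0 : 0 ≤ R := Real.sqrt_nonneg _
    have hR2 : R ^ 2 = D ^ 2 - 4 * (s₂ ^ 2 - k₁ ^ 2) := Real.sq_sqrt (by nlinarith)
    have hRD : R ≤ D := by
      apply le_of_sq_le_sq _ hD0.le
      rw [hR2]; linarith
    have hgp : gammaPlus s₁ s₂ k₁ k₂ ^ 2 = (D + R) / 2 := Real.sq_sqrt (by linarith)
    have hgm : gammaMinus s₁ s₂ k₁ k₂ ^ 2 = (D - R) / 2 := Real.sq_sqrt (by linarith)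
    have hgp0 : 0 ≤ gammaPlus s₁ s₂ k₁ k₂ := Real.sqrt_nonneg _
    have hgm0 : 0 ≤ gammaMinus s₁ s₂ k₁ k₂ := Real.sqrt_nonneg _
    set p := gammaPlus s₁ s₂ k₁ k₂
    set m := gammaMinus s₁ s₂ k₁ k₂
    -- Since `γ₊ γ₋ = S` and `γ₊² + γ₋² = D`, the quantity `D - 2 S` is the square of the gap `γ₊ -
    -- γ₋`. Either alternative of the window keeps this gap below 4π, whatever the index `l`.
    have hpm : p * m = S := by
      refine (pow_left_inj₀ (mul_nonneg hgp0 hgm0) hS0 two_ne_zero).1 ?_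
      rw [mul_pow, hgp, hgm, hS2]
      linarith
    have hmp : m ≤ p := by
      apply le_of_sq_le_sq _ hgp0
      rw [hgp, hgm]; linarith
    have hdiff : (p - m) ^ 2 = D - 2 * S := by
      rw [← hpm]; linarith
    constructor
    · have : 0 ≤ (4 * Real.pi ^ 2) ^ 2 + s₁ ^ 2 * (4 * Real.pi ^ 2) := by positivity
      linarith
    · have hbd : p - m ≤ 4 * Real.pi := by
        rcases hw with hw | ⟨l, -, hl1, hl2⟩
        · linarith
        · linarith
      have : (p - m) ^ 2 ≤ (4 * Real.pi) ^ 2 := pow_le_pow_left₀ (by linarith) hbd 2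
      linarith

theorem specDenom_le {s₁ s₂ k₁ k₂ r : ℝ} (hr : |r| ≤ 1) :
    specDenom s₁ s₂ k₁ k₂ r ≤ 9 * (1 + s₁ ^ 2 + s₂ ^ 2 + k₁ ^ 2 + k₂ ^ 2) := by
  have hr1 : r ^ 2 ≤ 1 := (sq_le_one_iff_abs_le_one r).2 hr
  have hcs := Real.sin_sq_add_cos_sq r
  set c := Real.cos r
  set s := Real.sin r
  -- The two squares are those of the real and imaginary parts of the characteristic function on the
  -- imaginary axis.
  have e : specDenom s₁ s₂ k₁ k₂ r =
      (-r ^ 2 + s₂ + k₁ * c + k₂ * r * s) ^ 2 + (s₁ * r + k₂ * r * c - k₁ * s) ^ 2 := by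
    simp only [specDenom]
    linear_combination (-(k₂ ^ 2 * r ^ 2) - k₁ ^ 2) * hcs
  have hc : c ^ 2 ≤ 1 := by linarith [sq_nonneg s]
  have hs : s ^ 2 ≤ 1 := by linarith [sq_nonneg c]
  have four (a b c d : ℝ) : (a + b + c + d) ^ 2 ≤ 4 * (a ^ 2 + b ^ 2 + c ^ 2 + d ^ 2) := by
    nlinarith [sq_nonneg (a - b), sq_nonneg (a - c), sq_nonneg (a - d), sq_nonneg (b - c),
      sq_nonneg (b - d), sq_nonneg (c - d)]
  have b1 : (-r ^ 2) ^ 2 ≤ 1 := by nlinarith [sq_nonneg r]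
  have bd {a x : ℝ} (h : x ^ 2 ≤ 1) : (a * x) ^ 2 ≤ a ^ 2 := by
    rw [mul_pow]; nlinarith [sq_nonneg a]
  have b2 := bd (a := k₁) hc
  have b3 := (bd (a := k₂ * r) hs).trans (bd (a := k₂) hr1)
  have b4 := bd (a := s₁) hr1
  have b5 := (bd (a := k₂ * r) hc).trans (bd (a := k₂) hr1)
  have b6 := bd (a := -k₁) hs
  have f1 := four (-r ^ 2) s₂ (k₁ * c) (k₂ * r * s)
  have f2 := four (s₁ * r) (k₂ * r * c) (-k₁ * s) 0
  have : (s₁ * r + k₂ * r * c - k₁ * s) ^ 2 = (s₁ * r + k₂ * r * c + -k₁ * s + 0) ^ 2 := by ring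
  rw [e, this]
  linarith [sq_nonneg s₁, sq_nonneg s₂, sq_nonneg k₁, sq_nonneg k₂]

/-- The bounded gains give one upper bound `C` for all denominators on `[0, 1]`, and this interval
alone contributes at least `1 / C`. -/
theorem specInf_pos (s₁ s₂ : ℝ) : 0 < specInf s₁ s₂ := by
  set C : ℝ := 9 * (1 + s₁ ^ 2 + s₂ ^ 2 +
    (s₂ ^ 2 + (4 * Real.pi ^ 2) ^ 2 + s₁ ^ 2 * (4 * Real.pi ^ 2)) +
      (s₁ ^ 2 + 16 * Real.pi ^ 2 + 2 * s₂))
  have hpos : 0 < (ENNReal.ofReal C)⁻¹ := ENNReal.inv_pos.2 ENNReal.ofReal_ne_top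
  refine hpos.trans_le (le_iInf₂ fun k hk => ?_)
  obtain ⟨h1, h2⟩ := hk.sq_gain_le
  calc (ENNReal.ofReal C)⁻¹ = ∫⁻ _ in Set.Icc (0 : ℝ) 1, (ENNReal.ofReal C)⁻¹ := by simp
    _ ≤ ∫⁻ r in Set.Icc (0 : ℝ) 1, (ENNReal.ofReal (specDenom s₁ s₂ k.1 k.2 r))⁻¹ := by
      refine setLIntegral_mono' measurableSet_Icc fun r hr => ?_
      refine ENNReal.inv_le_inv.2 (ENNReal.ofReal_le_ofReal ?_)
      refine (specDenom_le (abs_le.2 ⟨by linarith [hr.1], hr.2⟩)).trans ?_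
      simp only [C]
      linarith
    _ ≤ specFun s₁ s₂ k.1 k.2 := setLIntegral_le_lintegral _ _

theorem inRegion_zero_gain {s₁ s₂ : ℝ} (h₁ : 0 < s₁) (h₂ : 0 < s₂) : InRegion s₁ s₂ 0 0 := by
  refine Or.inl ⟨h₁.le, h₂.le, by simpa using pow_pos h₂ 2, by simpa, by simpa, ?_⟩
  have : √(s₂ ^ 2 - 0 ^ 2) = s₂ := by
    rw [zero_pow two_ne_zero, sub_zero, Real.sqrt_sq h₂.le]
  rw [this]
  nlinarith

theorem specDenom_zero_gain (s₁ s₂ r : ℝ) :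
    specDenom s₁ s₂ 0 0 r = (s₂ - r ^ 2) ^ 2 + s₁ ^ 2 * r ^ 2 := by
  simp only [specDenom]; ring

theorem specInf_lt_top {s₁ s₂ : ℝ} (h₁ : 0 < s₁) (h₂ : 0 < s₂) : specInf s₁ s₂ < ∞ := by
  have hle : specInf s₁ s₂ ≤ specFun s₁ s₂ 0 0 :=
    iInf₂_le_of_le ((0, 0) : ℝ × ℝ) (inRegion_zero_gain h₁ h₂) le_rfl
  refine hle.trans_lt ?_
  obtain ⟨c, hc, hcle⟩ : ∃ c : ℝ, 0 < c ∧ ∀ r : ℝ, c * (1 + r ^ 2) ≤ specDenom s₁ s₂ 0 0 r := by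
    -- The first entry serves `r² ≥ s₂ / 2`, where `s₁² r²` dominates. The second serves `r² ≤ s₂ /
    -- 2`, where `(s₂ - r²)² ≥ (s₂ / 2)²`.
    set c := min (s₁ ^ 2 * s₂ / (2 + s₂)) (s₂ ^ 2 / (4 * (1 + s₂))) with hcdef
    have hc1 : c * (2 + s₂) ≤ s₁ ^ 2 * s₂ := by
      rw [← le_div_iff₀ (by positivity)]; exact min_le_left _ _
    have hc2 : c * (4 * (1 + s₂)) ≤ s₂ ^ 2 := by
      rw [← le_div_iff₀ (by positivity)]; exact min_le_right _ _
    have hc : 0 < c := lt_min (by positivity) (by positivity)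
    refine ⟨c, hc, fun r => ?_⟩
    rw [specDenom_zero_gain]
    rcases le_total (r ^ 2) (s₂ / 2) with hr | hr
    · have : (s₂ / 2) ^ 2 ≤ (s₂ - r ^ 2) ^ 2 := pow_le_pow_left₀ (by linarith) (by linarith) 2
      have h3 : c * (1 + r ^ 2) ≤ c * (1 + s₂) := by gcongr; linarith
      nlinarith [mul_nonneg (sq_nonneg s₁) (sq_nonneg r)]
    · have hcs : c ≤ s₁ ^ 2 := by
        refine le_of_mul_le_mul_right ?_ h₂
        linarith
      have := mul_le_mul_of_nonneg_right hcs (sub_nonneg.2 hr)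
      linarith [sq_nonneg (s₂ - r ^ 2)]
  have hint : Integrable (fun r : ℝ => (c * (1 + r ^ 2))⁻¹) := by
    simpa only [mul_inv] using integrable_inv_one_add_sq.const_mul c⁻¹
  refine lt_of_le_of_lt (lintegral_mono fun r => ?_) hint.lintegral_lt_top
  rw [ENNReal.ofReal_inv_of_pos (by positivity)]
  exact ENNReal.inv_le_inv.2 (ENNReal.ofReal_le_ofReal (hcle r))

/-! ### Plancherel's theorem for integrable square-integrable functions -/

open FourierTransform SchwartzMap in
-- The Fourier transform on `Lp` is isometric, so it remains to identify it almost everywhere with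
-- the Fourier integral of `f`. Both have the same pairing with smooth compactly supported
-- functions, since the transform can be moved onto the test function.
theorem lintegral_enorm_fourier_sq {f : ℝ → ℂ} (hf : Integrable f) (hf2 : MemLp f 2) :
    ∫⁻ ξ, ‖𝓕 f ξ‖ₑ ^ 2 = ∫⁻ t, ‖f t‖ₑ ^ 2 := by
  set F : Lp ℂ 2 (volume : Measure ℝ) := hf2.toLp f
  set u : Lp ℂ 2 (volume : Measure ℝ) := 𝓕 F
  have hcont : Continuous (𝓕 f) :=
    VectorFourier.fourierIntegral_continuous Real.continuous_fourierChar
      (by exact continuous_inner) hf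
  have hae : ∀ᵐ ξ : ℝ, u ξ = 𝓕 f ξ := by
    refine ae_eq_of_integral_contDiff_smul_eq
      ((Lp.memLp u).locallyIntegrable (by norm_num)) hcont.locallyIntegrable fun g hg hgc => ?_
    have hgc' : HasCompactSupport (fun x => (g x : ℂ)) := hgc.comp_left Complex.ofReal_zero
    have hg' : ContDiff ℝ ((⊤ : ℕ∞) : WithTop ℕ∞) (fun x => (g x : ℂ)) :=
      Complex.ofRealCLM.contDiff.comp hg
    set G : 𝓢(ℝ, ℂ) := hgc'.toSchwartzMap hg' with hG
    have hGx (x : ℝ) : G x = g x := rfl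
    have h1 := congrArg (fun T : 𝓢'(ℝ, ℂ) => T G) (Lp.fourier_toTemperedDistribution_eq F)
    simp only [TemperedDistribution.fourier_apply, Lp.toTemperedDistribution_apply] at h1
    have h2 : ∫ x, (𝓕 G) x • F x = ∫ x, (𝓕 G) x • f x := by
      refine integral_congr_ae ?_
      filter_upwards [hf2.coeFn_toLp] with x hx
      rw [hx]
    have h3 : ∫ x, (𝓕 G) x • f x = ∫ x, G x • 𝓕 f x := by
      have := VectorFourier.integral_fourierIntegral_smul_eq_flip (μ := volume) (ν := volume)
        (L := innerₗ ℝ) (f := (G : ℝ → ℂ)) (g := f) Real.continuous_fourierChar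
        continuous_inner G.integrable hf
      rw [SchwartzMap.fourier_coe]
      rw [flip_innerₗ] at this
      exact this
    rw [h2, h3] at h1
    simpa [hGx] using h1.symm
  have hn : eLpNorm (u : ℝ → ℂ) 2 volume = eLpNorm f 2 volume := by
    have := Lp.norm_fourier_eq F
    rw [Lp.norm_def, Lp.norm_def, ENNReal.toReal_eq_toReal_iff' (Lp.eLpNorm_ne_top _)
      (Lp.eLpNorm_ne_top _)] at this
    rw [show (u : ℝ → ℂ) = (𝓕 F : Lp ℂ 2 (volume : Measure ℝ)) from rfl, this]
    exact eLpNorm_congr_ae hf2.coeFn_toLp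
  have key (w : ℝ → ℂ) : eLpNorm w 2 volume ^ 2 = ∫⁻ x, ‖w x‖ₑ ^ 2 := by
    have := eLpNorm_nnreal_pow_eq_lintegral (f := w) (μ := (volume : Measure ℝ)) (p := 2)
      two_ne_zero
    simpa using this
  rw [← key f, ← hn, key]
  exact lintegral_congr_ae (hae.mono fun ξ h => by simp only [h])

/-! ### Volterra convolution equations -/

/-- Fubini on the triangle `0 ≤ u ≤ s ≤ t`. The bound is required only there, because the kernels
grow and are controlled only for nonnegative arguments. -/
theorem integral_integral_triangle {F : ℝ → ℝ → ℝ} {t C : ℝ} (ht : 0 ≤ t)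
    (hm : Measurable (Function.uncurry F))
    (hb : ∀ s u, 0 ≤ u → u ≤ s → s ≤ t → |F s u| ≤ C) :
    ∫ s in (0 : ℝ)..t, ∫ u in (0 : ℝ)..s, F s u = ∫ u in (0 : ℝ)..t, ∫ s in u..t, F s u := by
  set G : ℝ → ℝ → ℝ := fun s u => Set.indicator {p : ℝ × ℝ | p.2 ≤ p.1} (Function.uncurry F) (s, u)
  have hG : Integrable (Function.uncurry G)
      ((volume.restrict (Set.Ioc 0 t)).prod (volume.restrict (Set.Ioc 0 t))) := by
    rw [Measure.prod_restrict]
    refine Measure.integrableOn_of_bounded (M := max C 0) ?_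
      (hm.indicator (measurableSet_le measurable_snd measurable_fst)).aestronglyMeasurable ?_
    · rw [Measure.prod_prod]
      exact ENNReal.mul_ne_top measure_Ioc_lt_top.ne measure_Ioc_lt_top.ne
    · refine (ae_restrict_iff' (measurableSet_Ioc.prod measurableSet_Ioc)).2 (.of_forall ?_)
      rintro ⟨s, u⟩ ⟨hs, hu⟩
      simp only [Function.uncurry, G, Set.indicator, Set.mem_ofPred_eq]
      split_ifs with hus
      · exact (hb s u hu.1.le hus hs.2).trans (le_max_left _ _)
      · simp
  rw [intervalIntegral.integral_of_le ht, intervalIntegral.integral_of_le ht]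
  calc ∫ s in Set.Ioc 0 t, ∫ u in (0 : ℝ)..s, F s u
      = ∫ s in Set.Ioc 0 t, ∫ u in Set.Ioc 0 t, G s u := by
        refine setIntegral_congr_fun measurableSet_Ioc fun s hs => ?_
        rw [intervalIntegral.integral_of_le hs.1.le, ← integral_indicator measurableSet_Ioc,
          ← integral_indicator measurableSet_Ioc]
        congr 1 with u
        simp only [Set.indicator, G, Set.mem_Ioc, Set.mem_ofPred_eq, Function.uncurry]
        have := hs.2
        split_ifs <;> grind
    _ = ∫ u in Set.Ioc 0 t, ∫ s in Set.Ioc 0 t, G s u := integral_integral_swap hG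
    _ = _ := by
        refine setIntegral_congr_fun measurableSet_Ioc fun u hu => ?_
        rw [intervalIntegral.integral_of_le hu.2, integral_Ioc_eq_integral_Ioo (x := u),
          ← integral_Icc_eq_integral_Ioo,
          ← integral_indicator measurableSet_Ioc, ← integral_indicator measurableSet_Icc]
        congr 1 with s
        simp only [Set.indicator, G, Set.mem_Ioc, Set.mem_Icc, Set.mem_ofPred_eq, Function.uncurry]
        have := hu.1
        split_ifs <;> grind

theorem continuous_integral_mul_indicator_sub {κ u : ℝ → ℝ} (hκ : IntegrableOn κ (Set.Ioi 0))
    (hu : Continuous u) {B : ℝ} (hB : ∀ x, |u x| ≤ B) :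
    Continuous fun t => ∫ r in Set.Ioi (0 : ℝ), κ r * (Set.Ici (0 : ℝ)).indicator u (t - r) := by
  refine continuous_iff_continuousAt.2 fun t₀ => ?_
  have hum : Measurable ((Set.Ici (0 : ℝ)).indicator u) := hu.measurable.indicator measurableSet_Ici
  refine continuousAt_of_dominated (bound := fun r => |κ r| * B) ?_ ?_ ?_ ?_
  · exact .of_forall fun t => hκ.aestronglyMeasurable.mul
      (hum.comp (measurable_const.sub measurable_id)).aestronglyMeasurable
  · refine .of_forall fun t => .of_forall fun r => ?_
    rw [norm_mul, Real.norm_eq_abs, Real.norm_eq_abs]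
    refine mul_le_mul_of_nonneg_left ?_ (abs_nonneg _)
    simp only [Set.indicator]
    split_ifs
    · exact hB _
    · simpa using (abs_nonneg _).trans (hB 0)
  · exact hκ.abs.mul_const B
  · have : ∀ᵐ r ∂(volume.restrict (Set.Ioi (0 : ℝ))), r ≠ t₀ :=
      ae_restrict_of_ae (by simp [ae_iff])
    filter_upwards [this] with r hr
    refine continuousAt_const.mul ?_
    have hc : ContinuousAt ((Set.Ici (0 : ℝ)).indicator u) (t₀ - r) := by
      rcases lt_or_gt_of_ne hr with h | h
      · refine hu.continuousAt.congr ?_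
        filter_upwards [lt_mem_nhds (sub_pos.2 h)] with x hx
        rw [Set.indicator_of_mem (Set.mem_Ici.2 hx.le)]
      · refine (continuousAt_const (y := (0 : ℝ))).congr ?_
        filter_upwards [gt_mem_nhds (sub_neg.2 h)] with x hx
        rw [Set.indicator_of_notMem (by simpa using hx)]
    exact ContinuousAt.comp (f := fun t => t - r) hc (by fun_prop)

/-- Banach's fixed point theorem for `u(t) = exp(-σ t) Ψ(t)`: the exponential weight turns `k` into
a kernel of `L¹` norm at most `1 / 2`. -/
theorem exists_volterra_solution {k : ℝ → ℝ} (hk : Measurable k) {C : ℝ}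
    (hC : ∀ r, 0 ≤ r → |k r| ≤ C * Real.exp r) :
    ∃ Ψ : ℝ → ℝ, Continuous Ψ ∧
      ∀ t, 0 ≤ t → Ψ t + ∫ r in (0 : ℝ)..t, k r * Ψ (t - r) = 1 := by
  have hC0 : 0 ≤ C := by simpa using (abs_nonneg _).trans (hC 0 le_rfl)
  -- With this rate the weighted kernel is at most `C exp(-(1 + 2 C) r)`, whose integral `C / (1 + 2
  -- C)` is below `1 / 2`.
  set σ : ℝ := 2 + 2 * C with hσ
  set κ : ℝ → ℝ := fun r => Real.exp (-σ * r) * k r with hκdef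
  have hκb : ∀ r ∈ Set.Ioi (0 : ℝ), |κ r| ≤ C * Real.exp (-(1 + 2 * C) * r) := by
    intro r hr
    have : Real.exp (-(1 + 2 * C) * r) = Real.exp (-σ * r) * Real.exp r := by
      rw [← Real.exp_add, hσ]; ring_nf
    rw [this, hκdef, abs_mul, abs_of_pos (Real.exp_pos _)]
    nlinarith [hC r (le_of_lt hr), Real.exp_pos (-σ * r)]
  have hneg : -(1 + 2 * C) < 0 := by linarith
  have hbint : IntegrableOn (fun r => C * Real.exp (-(1 + 2 * C) * r)) (Set.Ioi 0) :=
    (integrableOn_exp_mul_Ioi hneg 0).const_mul C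
  have hκm : Measurable κ := by fun_prop
  have hκ : IntegrableOn κ (Set.Ioi 0) :=
    Integrable.mono' hbint hκm.aestronglyMeasurable
      ((ae_restrict_iff' measurableSet_Ioi).2 (.of_forall hκb))
  have hκ1 : ∫ r in Set.Ioi (0 : ℝ), |κ r| ≤ 1 / 2 := by
    refine (setIntegral_mono_on hκ.abs hbint measurableSet_Ioi hκb).trans ?_
    rw [integral_const_mul, integral_exp_mul_Ioi hneg]
    simp only [mul_zero, Real.exp_zero]
    rw [neg_div_neg_eq, ← mul_div_assoc, div_le_div_iff₀ (by linarith) two_pos]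
    linarith
  have hbound (w : ℝ → ℝ) (B : ℝ) (hB : ∀ x, |w x| ≤ B) (t : ℝ) :
      |∫ r in Set.Ioi (0 : ℝ), κ r * (Set.Ici (0 : ℝ)).indicator w (t - r)| ≤ 1 / 2 * B := by
    have hB0 := (abs_nonneg _).trans (hB 0)
    rw [← Real.norm_eq_abs]
    refine (norm_integral_le_of_norm_le (hκ.abs.mul_const B) (.of_forall fun r => ?_)).trans ?_
    · rw [norm_mul, Real.norm_eq_abs, Real.norm_eq_abs]
      refine mul_le_mul_of_nonneg_left ?_ (abs_nonneg _)
      simp only [Set.indicator]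
      split_ifs
      · exact hB _
      · simpa using hB0
    · rw [integral_mul_const]
      exact mul_le_mul_of_nonneg_right hκ1 hB0
  have hub (u : BoundedContinuousFunction ℝ ℝ) (x : ℝ) : |u x| ≤ ‖u‖ := u.norm_coe_le_norm x
  -- Replacing `t` by `max t 0` keeps the inhomogeneity bounded on the whole line. The values at
  -- negative times never enter the convolution, thanks to the indicator.
  let T : BoundedContinuousFunction ℝ ℝ → BoundedContinuousFunction ℝ ℝ := fun u =>
    BoundedContinuousFunction.ofNormedAddCommGroup
      (fun t => Real.exp (-σ * max t 0) -
        ∫ r in Set.Ioi (0 : ℝ), κ r * (Set.Ici (0 : ℝ)).indicator u (t - r))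
      ((by fun_prop : Continuous fun t : ℝ => Real.exp (-σ * max t 0)).sub
        (continuous_integral_mul_indicator_sub hκ u.continuous (hub u)))
      (1 + 1 / 2 * ‖u‖) (fun t => by
        refine (norm_sub_le _ _).trans (add_le_add ?_ (hbound u ‖u‖ (hub u) t))
        rw [Real.norm_eq_abs, Real.abs_exp, Real.exp_le_one_iff]
        have : 0 ≤ max t 0 := le_max_right _ _
        nlinarith)
  have hT : ContractingWith (1 / 2) T := by
    refine ⟨by norm_num, LipschitzWith.of_dist_le_mul fun u v => ?_⟩
    refine (BoundedContinuousFunction.dist_le (by positivity)).2 fun t => ?_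
    have hi (w : BoundedContinuousFunction ℝ ℝ) : IntegrableOn
        (fun r => κ r * (Set.Ici (0 : ℝ)).indicator w (t - r)) (Set.Ioi 0) := by
      refine Integrable.mono' (hκ.abs.mul_const ‖w‖) (hκ.aestronglyMeasurable.mul
        ((w.continuous.measurable.indicator measurableSet_Ici).comp
          (measurable_const.sub measurable_id)).aestronglyMeasurable) (.of_forall fun r => ?_)
      rw [norm_mul, Real.norm_eq_abs, Real.norm_eq_abs]
      refine mul_le_mul_of_nonneg_left ?_ (abs_nonneg _)
      simp only [Set.indicator]
      split_ifs
      · exact hub w _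
      · simp
    have e : T u t - T v t =
        -∫ r in Set.Ioi (0 : ℝ), κ r * (Set.Ici (0 : ℝ)).indicator (u - v : ℝ → ℝ) (t - r) := by
      have : ∫ r in Set.Ioi (0 : ℝ), κ r * (Set.Ici (0 : ℝ)).indicator (u - v : ℝ → ℝ) (t - r) =
          (∫ r in Set.Ioi (0 : ℝ), κ r * (Set.Ici (0 : ℝ)).indicator u (t - r)) -
            ∫ r in Set.Ioi (0 : ℝ), κ r * (Set.Ici (0 : ℝ)).indicator v (t - r) := by
        rw [← integral_sub (hi u) (hi v)]
        congr 1 with r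
        simp only [Set.indicator]
        split_ifs <;> simp [mul_sub]
      rw [this]
      simp only [T, BoundedContinuousFunction.coe_ofNormedAddCommGroup]
      ring
    rw [Real.dist_eq, e, abs_neg]
    refine (hbound _ (dist u v) (fun x => ?_) t).trans_eq (by norm_num)
    rw [dist_eq_norm]
    exact hub (u - v) x
  obtain ⟨u, hu⟩ : ∃ u, T u = u := ⟨_, hT.fixedPoint_isFixedPt⟩
  refine ⟨fun t => Real.exp (σ * t) * u t, by fun_prop, fun t ht => ?_⟩
  have hut := congrArg (fun w : BoundedContinuousFunction ℝ ℝ => w t) hu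
  simp only [T, BoundedContinuousFunction.coe_ofNormedAddCommGroup, max_eq_left ht] at hut
  have e : ∫ r in Set.Ioi (0 : ℝ), κ r * (Set.Ici (0 : ℝ)).indicator u (t - r) =
      ∫ r in (0 : ℝ)..t, κ r * u (t - r) := by
    rw [intervalIntegral.integral_of_le ht, ← integral_indicator measurableSet_Ioi,
      ← integral_indicator measurableSet_Ioc]
    congr 1 with r
    simp only [Set.indicator, Set.mem_Ioi, Set.mem_Ici, Set.mem_Ioc, sub_nonneg]
    split_ifs <;> grind
  have e2 : ∫ r in (0 : ℝ)..t, k r * (Real.exp (σ * (t - r)) * u (t - r)) =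
      Real.exp (σ * t) * ∫ r in (0 : ℝ)..t, κ r * u (t - r) := by
    rw [← intervalIntegral.integral_const_mul]
    congr 1 with r
    have : Real.exp (σ * (t - r)) = Real.exp (σ * t) * Real.exp (-σ * r) := by
      rw [← Real.exp_add]; ring_nf
    rw [this, hκdef]
    ring
  have e3 : Real.exp (σ * t) * Real.exp (-σ * t) = 1 := by
    rw [← Real.exp_add]; simp
  rw [e] at hut
  beta_reduce
  rw [e2, ← hut]
  linear_combination e3

theorem exists_bound_Icc {k : ℝ → ℝ} (hk : Continuous k) (t : ℝ) :
    ∃ C, 0 ≤ C ∧ ∀ s ∈ Set.Icc 0 t, |k s| ≤ C := by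
  obtain ⟨C, hC⟩ := isCompact_Icc.exists_bound_of_continuousOn (f := k) hk.continuousOn
    (s := Set.Icc 0 t)
  exact ⟨max C 0, le_max_right _ _, fun s hs => (hC s hs).trans (le_max_left _ _)⟩

theorem abs_le_of_exp_bound {k : ℝ → ℝ} {C : ℝ} (hC : ∀ r, 0 ≤ r → |k r| ≤ C * Real.exp r) {r t : ℝ}
    (hr : 0 ≤ r) (hrt : r ≤ t) : |k r| ≤ C * Real.exp t := by
  have hC0 : 0 ≤ C := by simpa using (abs_nonneg _).trans (hC 0 le_rfl)
  exact (hC r hr).trans (mul_le_mul_of_nonneg_left (Real.exp_le_exp.2 hrt) hC0)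

/-- If `Ψ + k ∗ Ψ = 1`, then the primitive `Φ` of `Ψ` satisfies `Φ + k ∗ Φ = t`. -/
theorem primitive_volterra {k Ψ : ℝ → ℝ} (hk : Measurable k) {C : ℝ}
    (hC : ∀ r, 0 ≤ r → |k r| ≤ C * Real.exp r) (hΨ : Continuous Ψ)
    (h : ∀ t, 0 ≤ t → Ψ t + ∫ r in (0 : ℝ)..t, k r * Ψ (t - r) = 1) {t : ℝ} (ht : 0 ≤ t) :
    (∫ s in (0 : ℝ)..t, Ψ s) + ∫ r in (0 : ℝ)..t, k r * ∫ s in (0 : ℝ)..(t - r), Ψ s = t := by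
  -- The equation for `Ψ` is integrated from `0` to `t`, and the order of integration in the
  -- convolution term is exchanged.
  have e1 : ∫ s in (0 : ℝ)..t, ∫ r in (0 : ℝ)..s, k r * Ψ (s - r) =
      ∫ r in (0 : ℝ)..t, ∫ s in r..t, k r * Ψ (s - r) := by
    obtain ⟨A, hA0, hA⟩ := exists_bound_Icc hΨ t
    refine integral_integral_triangle (F := fun s r => k r * Ψ (s - r)) (C := C * Real.exp t * A)
      ht ?_ fun s u hu hus hst => ?_
    · exact (hk.comp measurable_snd).mul (hΨ.measurable.comp (measurable_fst.sub measurable_snd))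
    · rw [abs_mul]
      have := abs_le_of_exp_bound hC hu (hus.trans hst)
      exact mul_le_mul this (hA _ ⟨by linarith, by linarith⟩) (abs_nonneg _)
        ((abs_nonneg _).trans this)
  have e2 : ∫ s in (0 : ℝ)..t, ∫ r in (0 : ℝ)..s, k r * Ψ (s - r) =
      ∫ s in (0 : ℝ)..t, (1 - Ψ s) := by
    refine intervalIntegral.integral_congr fun s hs => ?_
    rw [Set.uIcc_of_le ht] at hs
    exact eq_sub_of_add_eq' (h s hs.1)
  have e3 (r : ℝ) : ∫ s in r..t, k r * Ψ (s - r) = k r * ∫ s in (0 : ℝ)..(t - r), Ψ s := by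
    rw [intervalIntegral.integral_const_mul, intervalIntegral.integral_comp_sub_right (fun s => Ψ s),
      sub_self]
  simp only [e3] at e1
  rw [← e1, e2, intervalIntegral.integral_sub (by simp) (hΨ.intervalIntegrable _ _)]
  simp

/-- The variation-of-constants identity for `x + k ∗ x = g`, where `Ψ + k ∗ Ψ = 1`. -/
theorem integral_eq_volterra_resolvent {k Ψ x g : ℝ → ℝ} (hk : Measurable k) {C : ℝ}
    (hC : ∀ r, 0 ≤ r → |k r| ≤ C * Real.exp r) (hΨ : Continuous Ψ)
    (h : ∀ t, 0 ≤ t → Ψ t + ∫ r in (0 : ℝ)..t, k r * Ψ (t - r) = 1)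
    (hx : Continuous x) (hg : Continuous g)
    (hxg : ∀ s, 0 ≤ s → x s + ∫ u in (0 : ℝ)..s, k (s - u) * x u = g s) {t : ℝ} (ht : 0 ≤ t) :
    ∫ s in (0 : ℝ)..t, x s = ∫ s in (0 : ℝ)..t, Ψ (t - s) * g s := by
  -- Associativity of convolution: `Ψ ∗ g = Ψ ∗ x + (Ψ ∗ k) ∗ x = 1 ∗ x`.
  have e1 : ∫ s in (0 : ℝ)..t, ∫ u in (0 : ℝ)..s, Ψ (t - s) * (k (s - u) * x u) =
      ∫ u in (0 : ℝ)..t, ∫ s in u..t, Ψ (t - s) * (k (s - u) * x u) := by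
    obtain ⟨A, hA0, hA⟩ := exists_bound_Icc hΨ t
    obtain ⟨B, hB0, hB⟩ := exists_bound_Icc hx t
    refine integral_integral_triangle (F := fun s u => Ψ (t - s) * (k (s - u) * x u))
      (C := A * (C * Real.exp t * B)) ht ?_ fun s u hu hus hst => ?_
    · exact (hΨ.measurable.comp (measurable_const.sub measurable_fst)).mul
        ((hk.comp (measurable_fst.sub measurable_snd)).mul (hx.measurable.comp measurable_snd))
    · rw [abs_mul, abs_mul]
      have hks := abs_le_of_exp_bound hC (sub_nonneg.2 hus) (by linarith : s - u ≤ t)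
      exact mul_le_mul (hA _ ⟨by linarith, by linarith⟩)
        (mul_le_mul hks (hB _ ⟨hu, hus.trans hst⟩) (abs_nonneg _) ((abs_nonneg _).trans hks))
        (by positivity) hA0
  have e2 : ∫ s in (0 : ℝ)..t, ∫ u in (0 : ℝ)..s, Ψ (t - s) * (k (s - u) * x u) =
      ∫ s in (0 : ℝ)..t, (Ψ (t - s) * g s - Ψ (t - s) * x s) := by
    refine intervalIntegral.integral_congr fun s hs => ?_
    rw [Set.uIcc_of_le ht] at hs
    simp only [intervalIntegral.integral_const_mul]
    rw [← hxg s hs.1]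
    ring
  have e3 : ∫ u in (0 : ℝ)..t, ∫ s in u..t, Ψ (t - s) * (k (s - u) * x u) =
      ∫ u in (0 : ℝ)..t, (x u - Ψ (t - u) * x u) := by
    refine intervalIntegral.integral_congr fun u hu => ?_
    rw [Set.uIcc_of_le ht] at hu
    have e4 : ∫ s in u..t, Ψ (t - s) * (k (s - u) * x u) =
        (∫ r in (0 : ℝ)..(t - u), k r * Ψ (t - u - r)) * x u := by
      rw [← intervalIntegral.integral_mul_const, ← sub_self u,
        ← intervalIntegral.integral_comp_sub_right (fun r => k r * Ψ (t - u - r) * x u)]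
      congr 1 with s
      rw [sub_sub_sub_cancel_right]
      ring
    have := h (t - u) (sub_nonneg.2 hu.2)
    simp only [e4]
    linear_combination x u * this
  have hi1 : IntervalIntegrable (fun s => Ψ (t - s) * x s) volume 0 t :=
    Continuous.intervalIntegrable (by fun_prop) _ _
  have hi2 : IntervalIntegrable (fun s => Ψ (t - s) * g s) volume 0 t :=
    Continuous.intervalIntegrable (by fun_prop) _ _
  rw [e2, e3, intervalIntegral.integral_sub hi2 hi1,
    intervalIntegral.integral_sub (hx.intervalIntegrable _ _) hi1] at e1
  linarith

/-! ### The delay kernel and its transfer function -/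

/-- The kernel `k` for which the scalar delay equation
`x'' = -lam x - d x' - mu x(t - τ) - kap x'(t - τ) + …` takes the Volterra form `x + k ∗ x = …`. -/
noncomputable def delayKernel (d lam mu kap τ u : ℝ) : ℝ :=
  d + lam * u + if τ < u then kap + mu * (u - τ) else 0

theorem measurable_delayKernel (d lam mu kap τ : ℝ) : Measurable (delayKernel d lam mu kap τ) := by
  unfold delayKernel
  refine Measurable.add (by fun_prop) (Measurable.ite ?_ (by fun_prop) measurable_const)
  exact measurableSet_Ioi

theorem abs_delayKernel_le (d lam mu kap : ℝ) {τ : ℝ} (hτ : 0 ≤ τ) (r : ℝ) (hr : 0 ≤ r) :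
    |delayKernel d lam mu kap τ r| ≤ (|d| + |lam| + |kap| + |mu|) * Real.exp r := by
  have h1 : 1 ≤ Real.exp r := Real.one_le_exp hr
  have h2 : r ≤ Real.exp r := by linarith [Real.add_one_le_exp r]
  have e1 : |d| ≤ |d| * Real.exp r := le_mul_of_one_le_right (abs_nonneg _) h1
  have e2 : |lam * r| ≤ |lam| * Real.exp r := by
    rw [abs_mul, abs_of_nonneg hr]; gcongr
  have e3 : |if τ < r then kap + mu * (r - τ) else 0| ≤ (|kap| + |mu|) * Real.exp r := by
    split_ifs with h
    · refine (abs_add_le _ _).trans ?_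
      rw [add_mul, abs_mul mu, abs_of_nonneg (by linarith : 0 ≤ r - τ)]
      refine add_le_add (le_mul_of_one_le_right (abs_nonneg _) h1) ?_
      gcongr
      linarith
    · rw [abs_zero]; positivity
  have a1 := abs_add_le (d + lam * r) (if τ < r then kap + mu * (r - τ) else 0)
  have a2 := abs_add_le d (lam * r)
  unfold delayKernel
  linarith

/-- The characteristic function of the scalar delay equation. -/
noncomputable def delayCharFun (d lam mu kap τ : ℝ) (z : ℂ) : ℂ :=
  z ^ 2 + d * z + lam + (mu + kap * z) * Complex.exp (-z * τ)

theorem integrableOn_exp_neg_mul {z : ℂ} (hz : 0 < z.re) : IntegrableOn (fun t : ℝ => Complex.exp (-z * t)) (Set.Ioi 0) :=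
  integrableOn_exp_mul_complex_Ioi (by simpa using hz) 0

theorem integral_exp_neg_mul {z : ℂ} (hz : 0 < z.re) : ∫ t in Set.Ioi (0 : ℝ), Complex.exp (-z * t) = 1 / z := by
  rw [integral_exp_mul_complex_Ioi (by simpa using hz)]
  simp

/-- The function `t exp(-z t)` is the convolution square of `exp(-z t)`, so its integrability and
its integral `1 / z²` follow from the convolution theorem. -/
theorem integral_exp_neg_mul_convolution {z : ℂ} (x : ℝ) :
    ∫ t in (0 : ℝ)..x, Complex.exp (-z * t) * Complex.exp (-z * (x - t : ℝ)) =
      Complex.exp (-z * x) * x := by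
  have : ∀ t : ℝ, Complex.exp (-z * t) * Complex.exp (-z * (x - t : ℝ)) = Complex.exp (-z * x) := by
    intro t
    rw [← Complex.exp_add]
    push_cast
    ring_nf
  simp only [this, intervalIntegral.integral_const, sub_zero, Complex.real_smul]
  exact mul_comm _ _

theorem integrableOn_exp_neg_mul_id {z : ℂ} (hz : 0 < z.re) :
    IntegrableOn (fun t : ℝ => Complex.exp (-z * t) * t) (Set.Ioi 0) := by
  have := integrable_posConvolution (μ := volume) (ν := volume) (integrableOn_exp_neg_mul hz)
    (integrableOn_exp_neg_mul hz) (ContinuousLinearMap.mul ℝ ℂ)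
  unfold posConvolution at this
  rw [integrable_indicator_iff measurableSet_Ioi] at this
  simpa only [ContinuousLinearMap.mul_apply', integral_exp_neg_mul_convolution] using this

theorem integral_exp_neg_mul_id {z : ℂ} (hz : 0 < z.re) :
    ∫ t in Set.Ioi (0 : ℝ), Complex.exp (-z * t) * t = 1 / z ^ 2 := by
  have := integral_posConvolution (μ := volume) (ν := volume) (integrableOn_exp_neg_mul hz)
    (integrableOn_exp_neg_mul hz) (ContinuousLinearMap.mul ℝ ℂ)
  simp only [ContinuousLinearMap.mul_apply', integral_exp_neg_mul_convolution,
    integral_exp_neg_mul hz] at this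
  rw [this]
  field_simp

theorem integrableOn_exp_neg_mul_affine {z : ℂ} (hz : 0 < z.re) (a b : ℝ) :
    IntegrableOn (fun t : ℝ => Complex.exp (-z * t) * (a + b * t : ℝ)) (Set.Ioi 0) := by
  have := ((integrableOn_exp_neg_mul hz).const_mul (a : ℂ)).add
    ((integrableOn_exp_neg_mul_id hz).const_mul (b : ℂ))
  refine Integrable.congr this (.of_forall fun t => ?_)
  simp only [Pi.add_apply]
  push_cast
  ring

theorem integral_exp_neg_mul_affine {z : ℂ} (hz : 0 < z.re) (a b : ℝ) :
    ∫ t in Set.Ioi (0 : ℝ), Complex.exp (-z * t) * (a + b * t : ℝ) = a / z + b / z ^ 2 := by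
  have e : ∀ t : ℝ, Complex.exp (-z * t) * (a + b * t : ℝ) =
      a * Complex.exp (-z * t) + b * (Complex.exp (-z * t) * t) := by
    intro t; push_cast; ring
  simp only [e]
  rw [integral_add ((integrableOn_exp_neg_mul hz).const_mul (a : ℂ))
    ((integrableOn_exp_neg_mul_id hz).const_mul (b : ℂ)), integral_const_mul, integral_const_mul,
    integral_exp_neg_mul hz, integral_exp_neg_mul_id hz]
  ring

/-- A shift by `τ` costs the factor `exp(-z τ)`. The cutoff at `τ` absorbs the one at `0` because `τ
≥ 0`. -/
theorem indicator_exp_neg_mul_delay {z : ℂ} {τ : ℝ} (hτ : 0 ≤ τ) (a b t : ℝ) :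
    (Set.Ioi (0 : ℝ)).indicator
      (fun t => Complex.exp (-z * t) * ((if τ < t then a + b * (t - τ) else 0 : ℝ) : ℂ)) t =
    Complex.exp (-z * τ) * (Set.Ioi (0 : ℝ)).indicator
      (fun s => Complex.exp (-z * s) * (a + b * s : ℝ)) (t - τ) := by
  simp only [Set.indicator, Set.mem_Ioi, sub_pos]
  by_cases h : τ < t
  · rw [if_pos (hτ.trans_lt h), if_pos h, if_pos h, ← mul_assoc, ← Complex.exp_add]
    congr 2
    push_cast
    ring
  · simp [h]

theorem integrableOn_exp_neg_mul_delay {z : ℂ} (hz : 0 < z.re) {τ : ℝ} (hτ : 0 ≤ τ) (a b : ℝ) :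
    IntegrableOn (fun t : ℝ =>
      Complex.exp (-z * t) * ((if τ < t then a + b * (t - τ) else 0 : ℝ) : ℂ)) (Set.Ioi 0) := by
  rw [← integrable_indicator_iff measurableSet_Ioi]
  refine Integrable.congr ((((integrable_indicator_iff measurableSet_Ioi).2
    (integrableOn_exp_neg_mul_affine hz a b)).comp_sub_right τ).const_mul (Complex.exp (-z * τ)))
    (.of_forall fun t => (indicator_exp_neg_mul_delay hτ a b t).symm)

theorem integral_exp_neg_mul_delay {z : ℂ} (hz : 0 < z.re) {τ : ℝ} (hτ : 0 ≤ τ) (a b : ℝ) :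
    ∫ t in Set.Ioi (0 : ℝ),
      Complex.exp (-z * t) * ((if τ < t then a + b * (t - τ) else 0 : ℝ) : ℂ) =
    Complex.exp (-z * τ) * (a / z + b / z ^ 2) := by
  rw [← integral_indicator measurableSet_Ioi]
  simp only [indicator_exp_neg_mul_delay hτ]
  rw [integral_const_mul, integral_sub_right_eq_self
    (fun t => (Set.Ioi (0 : ℝ)).indicator (fun s => Complex.exp (-z * s) * (a + b * s : ℝ)) t),
    integral_indicator measurableSet_Ioi, integral_exp_neg_mul_affine hz]

theorem exp_neg_mul_delayKernel {z : ℂ} (d lam mu kap τ t : ℝ) :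
    Complex.exp (-z * t) * (delayKernel d lam mu kap τ t : ℂ) =
      Complex.exp (-z * t) * (d + lam * t : ℝ) +
        Complex.exp (-z * t) * ((if τ < t then kap + mu * (t - τ) else 0 : ℝ) : ℂ) := by
  rw [← mul_add, ← Complex.ofReal_add]
  rfl

/-- The Laplace transform of a solution of `Φ + k ∗ Φ = t` is the inverse of the characteristic
function. -/
theorem laplace_mul_delayCharFun {z : ℂ} (hz : 0 < z.re) (d lam mu kap : ℝ) {τ : ℝ} (hτ : 0 ≤ τ) {Φ : ℝ → ℝ}
    (hint : IntegrableOn (fun t : ℝ => Complex.exp (-z * t) * Φ t) (Set.Ioi 0))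
    (h : ∀ t, 0 ≤ t → Φ t + ∫ r in (0 : ℝ)..t, delayKernel d lam mu kap τ r * Φ (t - r) = t) :
    (∫ t in Set.Ioi (0 : ℝ), Complex.exp (-z * t) * Φ t) * delayCharFun d lam mu kap τ z = 1 := by
  have hz0 : z ≠ 0 := fun h0 => by simp [h0] at hz
  set k := delayKernel d lam mu kap τ
  have hk : IntegrableOn (fun t : ℝ => Complex.exp (-z * t) * k t) (Set.Ioi 0) := by
    simp only [k, exp_neg_mul_delayKernel]
    exact (integrableOn_exp_neg_mul_affine hz d lam).add (integrableOn_exp_neg_mul_delay hz hτ kap mu)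
  have hkv : ∫ t in Set.Ioi (0 : ℝ), Complex.exp (-z * t) * k t =
      d / z + lam / z ^ 2 + Complex.exp (-z * τ) * (kap / z + mu / z ^ 2) := by
    simp only [k, exp_neg_mul_delayKernel]
    rw [integral_add (integrableOn_exp_neg_mul_affine hz d lam)
      (integrableOn_exp_neg_mul_delay hz hτ kap mu), integral_exp_neg_mul_affine hz,
      integral_exp_neg_mul_delay hz hτ]
  have hconv := integral_posConvolution (μ := volume) (ν := volume) hk hint
    (ContinuousLinearMap.mul ℝ ℂ)
  simp only [ContinuousLinearMap.mul_apply'] at hconv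
  have e : ∀ t ∈ Set.Ioi (0 : ℝ),
      ∫ r in (0 : ℝ)..t, Complex.exp (-z * r) * k r * (Complex.exp (-z * (t - r : ℝ)) * Φ (t - r)) =
      Complex.exp (-z * t) * t - Complex.exp (-z * t) * Φ t := by
    intro t ht
    have e1 : ∀ r : ℝ,
        Complex.exp (-z * r) * k r * (Complex.exp (-z * (t - r : ℝ)) * Φ (t - r)) =
          Complex.exp (-z * t) * ((k r * Φ (t - r) : ℝ) : ℂ) := by
      intro r
      have : Complex.exp (-z * t) = Complex.exp (-z * r) * Complex.exp (-z * (t - r : ℝ)) := by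
        rw [← Complex.exp_add]; push_cast; ring_nf
      rw [this]; push_cast; ring
    simp only [e1]
    rw [intervalIntegral.integral_const_mul, intervalIntegral.integral_ofReal,
      eq_sub_of_add_eq' (h t (le_of_lt ht))]
    push_cast
    ring
  rw [setIntegral_congr_fun measurableSet_Ioi e,
    integral_sub (integrableOn_exp_neg_mul_id hz) hint, integral_exp_neg_mul_id hz, hkv] at hconv
  -- The convolution theorem has given `k̂ I = 1 / z² - I`, and `1 + k̂` is the characteristic
  -- function divided by `z²`.
  set I := ∫ t in Set.Ioi (0 : ℝ), Complex.exp (-z * t) * Φ t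
  unfold delayCharFun
  rw [neg_mul] at hconv ⊢
  field_simp at hconv
  linear_combination -hconv

theorem continuous_delayCharFun (d lam mu kap τ : ℝ) : Continuous (delayCharFun d lam mu kap τ) := by
  unfold delayCharFun
  fun_prop

/-- The dimensionless variable is `r = τ ω` with `ω` the physical frequency, so the quadratic
characteristic function scales by `τ²`. -/
theorem specDenom_eq_norm_sq (d lam mu kap : ℝ) {τ : ℝ} (hτ : 0 < τ) (r : ℝ) :
    specDenom (d * τ) (lam * τ ^ 2) (mu * τ ^ 2) (kap * τ) r =
      τ ^ 4 * ‖delayCharFun d lam mu kap τ ((r / τ : ℝ) * Complex.I)‖ ^ 2 := by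
  have hcs := Real.sin_sq_add_cos_sq r
  have e : delayCharFun d lam mu kap τ ((r / τ : ℝ) * Complex.I) =
      ((-(r / τ) ^ 2 + lam + mu * Real.cos r + kap * (r / τ) * Real.sin r : ℝ) : ℂ) +
      ((d * (r / τ) + kap * (r / τ) * Real.cos r - mu * Real.sin r : ℝ) : ℂ) * Complex.I := by
    have : -(((r / τ : ℝ) : ℂ) * Complex.I) * τ = ((-r : ℝ) : ℂ) * Complex.I := by
      have : (τ : ℂ) ≠ 0 := by exact_mod_cast hτ.ne'
      push_cast
      field_simp
    rw [delayCharFun, this, Complex.exp_mul_I, ← Complex.ofReal_cos, ← Complex.ofReal_sin,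
      Real.cos_neg, Real.sin_neg]
    push_cast
    have hI : Complex.I ^ 2 = -1 := Complex.I_sq
    linear_combination (((r : ℂ) / τ) ^ 2 - kap * (r / τ) * Complex.sin r) * hI
  rw [e, ← Complex.normSq_eq_norm_sq, Complex.normSq_add_mul_I]
  simp only [specDenom]
  field_simp
  linear_combination (-(kap ^ 2 * τ ^ 2 * r ^ 2) - mu ^ 2 * τ ^ 4) * hcs

/-- At `ξ`, the Fourier transform of `exp(-ε t) Φ(t)` on the half-line is the inverse of the
characteristic function at `ε + 2πiξ`. Plancherel bounds its energy by that of `Φ` for each `ε > 0`,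
and Fatou's lemma passes to the imaginary axis. -/
theorem lintegral_inv_delayCharFun_le (d lam mu kap : ℝ) {τ : ℝ} (hτ : 0 ≤ τ) {Φ : ℝ → ℝ}
    (hΦ : Continuous Φ)
    (h : ∀ t, 0 ≤ t → Φ t + ∫ r in (0 : ℝ)..t, delayKernel d lam mu kap τ r * Φ (t - r) = t) :
    ∫⁻ ξ : ℝ, (‖delayCharFun d lam mu kap τ ((2 * Real.pi * ξ : ℝ) * Complex.I)‖ₑ ^ 2)⁻¹ ≤
      ∫⁻ t in Set.Ioi (0 : ℝ), ENNReal.ofReal (Φ t ^ 2) := by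
  by_cases htop : ∫⁻ t in Set.Ioi (0 : ℝ), ENNReal.ofReal (Φ t ^ 2) = ∞
  · rw [htop]; exact le_top
  have hΦ2 : IntegrableOn (fun t => Φ t ^ 2) (Set.Ioi 0) :=
    (lintegral_ofReal_ne_top_iff_integrable (by fun_prop) (.of_forall fun t => sq_nonneg _)).1 htop
  have key (ε : ℝ) (hε : 0 < ε) :
      ∫⁻ ξ : ℝ, (‖delayCharFun d lam mu kap τ (ε + (2 * Real.pi * ξ : ℝ) * Complex.I)‖ₑ ^ 2)⁻¹ ≤
        ∫⁻ t in Set.Ioi (0 : ℝ), ENNReal.ofReal (Φ t ^ 2) := by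
    set F : ℝ → ℂ := (Set.Ioi (0 : ℝ)).indicator fun t => Complex.exp (-(ε : ℂ) * t) * Φ t with hF
    have hnorm (z : ℂ) (t : ℝ) : ‖Complex.exp (-z * t) * Φ t‖ = Real.exp (-z.re * t) * |Φ t| := by
      rw [norm_mul, Complex.norm_exp, Complex.norm_real]
      simp
    have hint (z : ℂ) (hz : 0 < z.re) :
        IntegrableOn (fun t : ℝ => Complex.exp (-z * t) * Φ t) (Set.Ioi 0) := by
      -- The product of the square-integrable functions `exp(-Re z t)` and `Φ` is integrable, being
      -- at most the sum of their squares.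
      have hE : IntegrableOn (fun t : ℝ => Real.exp (-(2 * z.re) * t)) (Set.Ioi 0) :=
        integrableOn_exp_mul_Ioi (by linarith) 0
      refine Integrable.mono' (hE.add hΦ2) (by fun_prop) (.of_forall fun t => ?_)
      have e2 : Real.exp (-(2 * z.re) * t) = Real.exp (-z.re * t) ^ 2 := by
        rw [← Real.exp_nat_mul]; ring_nf
      rw [hnorm, Pi.add_apply, e2, ← sq_abs (Φ t)]
      nlinarith [sq_nonneg (Real.exp (-z.re * t) - |Φ t|), Real.exp_pos (-z.re * t), abs_nonneg (Φ t)]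
    have hF1 : Integrable F := (integrable_indicator_iff measurableSet_Ioi).2 (hint ε (by simpa))
    have hFsq (t : ℝ) : ‖F t‖ₑ ^ 2 ≤ (Set.Ioi (0 : ℝ)).indicator
        (fun t => ENNReal.ofReal (Φ t ^ 2)) t := by
      simp only [hF, Set.indicator]
      split_ifs with ht
      · rw [← ofReal_norm, ← ENNReal.ofReal_pow (norm_nonneg _), hnorm]
        refine ENNReal.ofReal_le_ofReal ?_
        rw [← sq_abs (Φ t)]
        refine pow_le_pow_left₀ (by positivity) (mul_le_of_le_one_left (abs_nonneg _) ?_) 2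
        rw [Real.exp_le_one_iff]
        have := mul_pos hε (Set.mem_Ioi.1 ht)
        simp only [Complex.ofReal_re]
        linarith
      · simp
    have hle : ∫⁻ t, ‖F t‖ₑ ^ 2 ≤ ∫⁻ t in Set.Ioi (0 : ℝ), ENNReal.ofReal (Φ t ^ 2) :=
      (lintegral_mono hFsq).trans_eq (lintegral_indicator measurableSet_Ioi _)
    have hF2 : MemLp F 2 := by
      refine ⟨hF1.aestronglyMeasurable, ?_⟩
      have := eLpNorm_nnreal_pow_eq_lintegral (f := F) (μ := (volume : Measure ℝ)) (p := 2)
        two_ne_zero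
      have h2 : eLpNorm F 2 volume ^ 2 = ∫⁻ x, ‖F x‖ₑ ^ 2 := by simpa using this
      have h3 : eLpNorm F 2 volume ^ 2 < ∞ := by
        rw [h2]; exact hle.trans_lt (lt_top_iff_ne_top.2 htop)
      exact (ENNReal.pow_lt_top_iff.1 h3).resolve_right two_ne_zero
    refine le_trans (le_of_eq ?_) ((lintegral_enorm_fourier_sq hF1 hF2).trans_le hle)
    refine lintegral_congr fun ξ => ?_
    set z : ℂ := ε + (2 * Real.pi * ξ : ℝ) * Complex.I with hz
    have hzre : 0 < z.re := by simpa [hz] using hε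
    have e : FourierTransform.fourier F ξ = ∫ t in Set.Ioi (0 : ℝ), Complex.exp (-z * t) * Φ t := by
      rw [Real.fourier_real_eq_integral_exp_smul, ← integral_indicator measurableSet_Ioi]
      congr 1 with t
      simp only [hF, Set.indicator]
      split_ifs
      · rw [smul_eq_mul, ← mul_assoc, ← Complex.exp_add, hz]
        congr 2
        push_cast
        ring
      · simp
    have hl := laplace_mul_delayCharFun hzre d lam mu kap hτ (hint z hzre) h
    rw [e, eq_inv_of_mul_eq_one_left hl, enorm_inv (right_ne_zero_of_mul_eq_one hl), ENNReal.inv_pow]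
  have hlim : ∀ ξ : ℝ, Tendsto (fun m : ℕ => (‖delayCharFun d lam mu kap τ
      ((1 / ((m : ℝ) + 1) : ℝ) + (2 * Real.pi * ξ : ℝ) * Complex.I)‖ₑ ^ 2)⁻¹) atTop
      (𝓝 (‖delayCharFun d lam mu kap τ ((2 * Real.pi * ξ : ℝ) * Complex.I)‖ₑ ^ 2)⁻¹) := by
    intro ξ
    -- Inversion is continuous on `ℝ≥0∞`, also at `0`, so zeros on the imaginary axis need no
    -- separate treatment.
    have hc : Continuous fun ε : ℝ => (‖delayCharFun d lam mu kap τ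
        ((ε : ℂ) + (2 * Real.pi * ξ : ℝ) * Complex.I)‖ₑ ^ 2)⁻¹ := by
      have : Continuous fun ε : ℝ => delayCharFun d lam mu kap τ
        ((ε : ℂ) + (2 * Real.pi * ξ : ℝ) * Complex.I) :=
        (continuous_delayCharFun d lam mu kap τ).comp (by fun_prop)
      exact continuous_inv.comp ((ENNReal.continuous_pow 2).comp this.enorm)
    have := (hc.tendsto 0).comp (tendsto_one_div_add_atTop_nhds_zero_nat (𝕜 := ℝ))
    simpa [Function.comp_def] using this
  calc ∫⁻ ξ : ℝ, (‖delayCharFun d lam mu kap τ ((2 * Real.pi * ξ : ℝ) * Complex.I)‖ₑ ^ 2)⁻¹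
      = ∫⁻ ξ : ℝ, liminf (fun m : ℕ => (‖delayCharFun d lam mu kap τ
      ((1 / ((m : ℝ) + 1) : ℝ) + (2 * Real.pi * ξ : ℝ) * Complex.I)‖ₑ ^ 2)⁻¹) atTop :=
        lintegral_congr fun ξ => (hlim ξ).liminf_eq.symm
    _ ≤ liminf (fun m : ℕ => ∫⁻ ξ : ℝ, (‖delayCharFun d lam mu kap τ
      ((1 / ((m : ℝ) + 1) : ℝ) + (2 * Real.pi * ξ : ℝ) * Complex.I)‖ₑ ^ 2)⁻¹) atTop := by
        refine lintegral_liminf_le fun m => ?_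
        have : Measurable fun ξ : ℝ => delayCharFun d lam mu kap τ
          ((1 / ((m : ℝ) + 1) : ℝ) + (2 * Real.pi * ξ : ℝ) * Complex.I) :=
          ((continuous_delayCharFun d lam mu kap τ).comp (by fun_prop)).measurable
        exact (this.enorm.pow_const 2).inv
    _ ≤ _ := by
        refine liminf_le_of_frequently_le' (Frequently.of_forall fun m => key _ ?_)
        positivity

/-- Change of variables `r = 2π τ ξ`. The factor `τ³` combines `τ⁴` from the denominator with one
`τ` lost in `dr`, and `2π` is the Fourier normalization. -/
theorem specFun_le_energy (d lam mu kap : ℝ) {τ : ℝ} (hτ : 0 < τ) {Φ : ℝ → ℝ} (hΦ : Continuous Φ)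
    (h : ∀ t, 0 ≤ t → Φ t + ∫ r in (0 : ℝ)..t, delayKernel d lam mu kap τ r * Φ (t - r) = t) :
    ENNReal.ofReal (τ ^ 3 / (2 * Real.pi)) *
      specFun (d * τ) (lam * τ ^ 2) (mu * τ ^ 2) (kap * τ) ≤
      ∫⁻ t in Set.Ioi (0 : ℝ), ENNReal.ofReal (Φ t ^ 2) := by
  refine le_trans (le_of_eq ?_) (lintegral_inv_delayCharFun_le d lam mu kap hτ.le hΦ h)
  have hpi := Real.pi_pos
  set g : ℝ → ℝ≥0∞ := fun ω => (‖delayCharFun d lam mu kap τ ((ω : ℝ) * Complex.I)‖ₑ ^ 2)⁻¹ with hg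
  have hgm : Measurable g := by
    have : Measurable fun ω : ℝ => delayCharFun d lam mu kap τ ((ω : ℝ) * Complex.I) :=
      ((continuous_delayCharFun d lam mu kap τ).comp (by fun_prop)).measurable
    exact (this.enorm.pow_const 2).inv
  have hscale (a : ℝ) (ha : 0 < a) : ∫⁻ x, g (a * x) = ENNReal.ofReal a⁻¹ * ∫⁻ x, g x := by
    rw [← lintegral_map hgm (measurable_const_mul a), Real.map_volume_mul_left ha.ne',
      lintegral_smul_measure, abs_of_pos (inv_pos.2 ha), smul_eq_mul]
  have hspec : specFun (d * τ) (lam * τ ^ 2) (mu * τ ^ 2) (kap * τ) =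
      ENNReal.ofReal (τ ^ 4)⁻¹ * ∫⁻ r, g (τ⁻¹ * r) := by
    rw [← lintegral_const_mul' _ _ ENNReal.ofReal_ne_top]
    refine lintegral_congr fun r => ?_
    rw [specDenom_eq_norm_sq d lam mu kap hτ, ENNReal.ofReal_mul (by positivity),
      ENNReal.mul_inv (.inl (by positivity)) (.inl ENNReal.ofReal_ne_top),
      ENNReal.ofReal_inv_of_pos (by positivity), hg, ENNReal.ofReal_pow (norm_nonneg _),
      ofReal_norm, div_eq_inv_mul]
  rw [hspec, hscale _ (inv_pos.2 hτ), hscale _ (by positivity), inv_inv, ← mul_assoc, ← mul_assoc,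
    ← ENNReal.ofReal_mul (by positivity), ← ENNReal.ofReal_mul (by positivity)]
  congr 2
  field_simp

/-! ### Representation of solutions of the scalar delay equation -/

/-- This separates the prescribed history from the part of the path after time `0`. The `min` and
`max` cover times before and after `τ` together. -/
theorem integral_comp_sub_delay {f : ℝ → ℝ} (hf : Continuous f) (τ t : ℝ) :
    ∫ s in (0 : ℝ)..t, f (s - τ) =
      (∫ s in (-τ)..(min (t - τ) 0), f s) + ∫ s in (0 : ℝ)..(max (t - τ) 0), f s := by
  rw [intervalIntegral.integral_comp_sub_right (fun s => f s), zero_sub]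
  rcases le_total (t - τ) 0 with h | h
  · simp [min_eq_left h, max_eq_right h]
  · rw [min_eq_right h, max_eq_left h]
    exact (intervalIntegral.integral_add_adjacent_intervals (hf.intervalIntegrable _ _)
      (hf.intervalIntegrable _ _)).symm

theorem integral_integral_comm_convolution {Ψ b : ℝ → ℝ} (hΨ : Continuous Ψ) (hb : Continuous b)
    {t : ℝ} (ht : 0 ≤ t) :
    ∫ s in (0 : ℝ)..t, Ψ (t - s) * ∫ u in (0 : ℝ)..s, b u =
      ∫ s in (0 : ℝ)..t, ∫ u in (0 : ℝ)..s, Ψ (s - u) * b u := by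
  obtain ⟨A, hA0, hA⟩ := exists_bound_Icc hΨ t
  obtain ⟨B, hB0, hB⟩ := exists_bound_Icc hb t
  have bound {r u : ℝ} (hr : r ∈ Set.Icc 0 t) (hu : u ∈ Set.Icc 0 t) : |Ψ r * b u| ≤ A * B := by
    rw [abs_mul]
    exact mul_le_mul (hA r hr) (hB u hu) (abs_nonneg _) hA0
  simp only [← intervalIntegral.integral_const_mul]
  rw [integral_integral_triangle (F := fun s u => Ψ (t - s) * b u) (C := A * B) ht
      (by exact Continuous.measurable (by fun_prop)) fun s u hu hus hst =>
        bound ⟨by linarith, by linarith⟩ ⟨hu, by linarith⟩,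
    integral_integral_triangle (F := fun s u => Ψ (s - u) * b u) (C := A * B) ht
      (by exact Continuous.measurable (by fun_prop)) fun s u hu hus hst =>
        bound ⟨by linarith, by linarith⟩ ⟨hu, by linarith⟩]
  congr 1 with u
  rw [intervalIntegral.integral_mul_const, intervalIntegral.integral_mul_const,
    intervalIntegral.integral_comp_sub_right (fun s => Ψ s),
    intervalIntegral.integral_comp_sub_left (fun s => Ψ s)]
  simp

theorem integral_sub_mul_eq_integral_integral {x : ℝ → ℝ} (hx : Continuous x) {t : ℝ}
    (ht : 0 ≤ t) :
    ∫ u in (0 : ℝ)..t, (t - u) * x u = ∫ s in (0 : ℝ)..t, ∫ u in (0 : ℝ)..s, x u := by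
  obtain ⟨B, hB0, hB⟩ := exists_bound_Icc hx t
  rw [integral_integral_triangle (F := fun _ u => x u) (C := B) ht
    (hx.measurable.comp measurable_snd) fun s u hu hus hst => hB u ⟨hu, hus.trans hst⟩]
  simp

/-- Cauchy's formula for repeated integration identifies `k ∗ x` with the integral terms of the
twice integrated delay equation. -/
theorem integral_delayKernel_mul (d lam mu kap : ℝ) {τ : ℝ} (hτ : 0 ≤ τ) {x : ℝ → ℝ}
    (hx : Continuous x) {t : ℝ} (ht : 0 ≤ t) :
    ∫ u in (0 : ℝ)..t, delayKernel d lam mu kap τ (t - u) * x u =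
      d * (∫ u in (0 : ℝ)..t, x u) + lam * (∫ s in (0 : ℝ)..t, ∫ u in (0 : ℝ)..s, x u) +
      kap * (∫ u in (0 : ℝ)..(max (t - τ) 0), x u) +
      mu * ∫ s in (0 : ℝ)..(max (t - τ) 0), ∫ u in (0 : ℝ)..s, x u := by
  have aff (a b p : ℝ) (hp : 0 ≤ p) : ∫ u in (0 : ℝ)..p, (a + b * (p - u)) * x u =
      a * (∫ u in (0 : ℝ)..p, x u) + b * ∫ s in (0 : ℝ)..p, ∫ u in (0 : ℝ)..s, x u := by
    rw [← integral_sub_mul_eq_integral_integral hx hp, ← intervalIntegral.integral_const_mul,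
      ← intervalIntegral.integral_const_mul, ← intervalIntegral.integral_add
        (Continuous.intervalIntegrable (by fun_prop) _ _)
        (Continuous.intervalIntegrable (by fun_prop) _ _)]
    congr 1 with u
    ring
  set p := max (t - τ) 0 with hp
  have hp0 : 0 ≤ p := le_max_right _ _
  have hind (u : ℝ) : (Set.Ioc 0 t).indicator
      (fun u => (if τ < t - u then kap + mu * (t - u - τ) else 0) * x u) u =
      (Set.Ioo 0 p).indicator (fun u => (kap + mu * (p - u)) * x u) u := by
    simp only [Set.indicator, Set.mem_Ioc, Set.mem_Ioo]
    by_cases h : 0 < u ∧ u < p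
    · have hpt : p = t - τ := by
        rcases max_cases (t - τ) 0 with h' | h' <;> grind
      rw [if_pos h, if_pos ⟨h.1, by linarith⟩, if_pos (by linarith), hpt]
      ring
    · rw [if_neg h]
      have : t - τ ≤ p := le_max_left _ _
      split_ifs with h1 h2
      · exact absurd ⟨h1.1, by linarith⟩ h
      · simp
      · rfl
  have hdel : ∫ u in (0 : ℝ)..t, (if τ < t - u then kap + mu * (t - u - τ) else 0) * x u =
      ∫ u in (0 : ℝ)..p, (kap + mu * (p - u)) * x u := by
    rw [intervalIntegral.integral_of_le ht, intervalIntegral.integral_of_le hp0,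
      integral_Ioc_eq_integral_Ioo (x := (0 : ℝ)) (y := p), ← integral_indicator measurableSet_Ioc,
      ← integral_indicator measurableSet_Ioo]
    simp only [hind]
  have hdeli : IntervalIntegrable
      (fun u => (if τ < t - u then kap + mu * (t - u - τ) else 0) * x u) volume 0 t := by
    rw [intervalIntegrable_iff_integrableOn_Ioc_of_le ht, ← integrable_indicator_iff
      measurableSet_Ioc]
    simp only [funext hind]
    refine (integrable_indicator_iff measurableSet_Ioo).2 ?_
    exact (Continuous.integrableOn_Icc (by fun_prop)).mono_set Set.Ioo_subset_Icc_self
  have hsplit : ∀ u, delayKernel d lam mu kap τ (t - u) * x u = (d + lam * (t - u)) * x u +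
      (if τ < t - u then kap + mu * (t - u - τ) else 0) * x u := fun u => by
    rw [delayKernel]; ring
  simp only [hsplit]
  rw [intervalIntegral.integral_add (Continuous.intervalIntegrable (by fun_prop) _ _) hdeli, hdel,
    aff d lam t ht, aff kap mu p hp0]
  ring

/-- Every solution of the forced scalar delay equation is the sum of a function that depends on the
initial data only and of the convolution of the forcing with `Ψ`. -/
theorem exists_delay_representation (d lam mu kap c : ℝ) {τ : ℝ} (hτ : 0 < τ) {Ψ : ℝ → ℝ}
    (hΨ : Continuous Ψ)
    (h : ∀ t, 0 ≤ t → Ψ t + ∫ r in (0 : ℝ)..t, delayKernel d lam mu kap τ r * Ψ (t - r) = 1)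
    (x₀ v₀ : ℝ → ℝ) :
    ∃ D : ℝ → ℝ, ∀ x v b : ℝ → ℝ, Continuous x → Continuous v → Continuous b →
      (∀ t ∈ Set.Icc (-τ) 0, x t = x₀ t ∧ v t = v₀ t) →
      (∀ t, 0 ≤ t → x t = x₀ 0 + ∫ s in (0 : ℝ)..t, v s) →
      (∀ t, 0 ≤ t → v t = v₀ 0 + (∫ s in (0 : ℝ)..t,
        (-(lam * x s) - d * v s - mu * x (s - τ) - kap * v (s - τ))) + c * b t) →
      ∀ t, 0 < t → x t = D t + c * ∫ s in (0 : ℝ)..t, Ψ (t - s) * b s := by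
  -- `E` and `D₂` collect the contributions of the initial data after one and two integrations. They
  -- do not involve `x`, `v` or `b`.
  set E : ℝ → ℝ := fun s => v₀ 0 + d * x₀ 0 - mu * (∫ u in (-τ)..(min (s - τ) 0), x₀ u) -
    kap * ((∫ u in (-τ)..(min (s - τ) 0), v₀ u) - x₀ 0) with hE
  set D₂ : ℝ → ℝ := fun t => x₀ 0 + (∫ s in (0 : ℝ)..t, E s) -
    kap * (x₀ 0 * (min (t - τ) 0 + τ)) with hD₂
  -- Variation of constants gives `∫ x = Ψ ∗ D₂ + c ∫ (Ψ ∗ b)`, so the deterministic part of `x` is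
  -- the derivative of `Ψ ∗ D₂`. It exists for `t > 0` because the other two terms are continuously
  -- differentiable.
  refine ⟨deriv fun t => ∫ s in (0 : ℝ)..t, Ψ (t - s) * D₂ s, ?_⟩
  intro x v b hx hv hb hinit hxe hve
  have hprim {f : ℝ → ℝ} (hf : Continuous f) (a : ℝ) : Continuous fun t => ∫ s in a..t, f s :=
    intervalIntegral.continuous_primitive (fun _ _ => hf.intervalIntegrable _ _) a
  set X : ℝ → ℝ := fun t => ∫ s in (0 : ℝ)..t, x s with hX
  have hXc : Continuous X := hprim hx 0
  have hx00 : x 0 = x₀ 0 := (hinit 0 ⟨by linarith, le_rfl⟩).1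
  have hEx {s : ℝ} (hs : 0 ≤ s) : E s = v₀ 0 + d * x₀ 0 -
      mu * (∫ u in (-τ)..(min (s - τ) 0), x u) -
      kap * ((∫ u in (-τ)..(min (s - τ) 0), v u) - x₀ 0) := by
    have hle : -τ ≤ min (s - τ) 0 := le_min (by linarith) (by linarith)
    have hmem : ∀ u ∈ Set.uIcc (-τ) (min (s - τ) 0), u ∈ Set.Icc (-τ) 0 := by
      intro u hu
      rw [Set.uIcc_of_le hle] at hu
      exact ⟨hu.1, hu.2.trans (min_le_right _ _)⟩
    rw [hE]
    simp only
    rw [intervalIntegral.integral_congr fun u hu => (hinit u (hmem u hu)).1,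
      intervalIntegral.integral_congr fun u hu => (hinit u (hmem u hu)).2]
  have hv2 {t : ℝ} (ht : 0 ≤ t) : v t = E t - lam * X t - d * x t - mu * X (max (t - τ) 0) -
      kap * x (max (t - τ) 0) + c * b t := by
    have i1 : IntervalIntegrable (fun s => -(lam * x s)) volume 0 t :=
      Continuous.intervalIntegrable (by fun_prop) _ _
    have i2 : IntervalIntegrable (fun s => d * v s) volume 0 t :=
      Continuous.intervalIntegrable (by fun_prop) _ _
    have i3 : IntervalIntegrable (fun s => mu * x (s - τ)) volume 0 t :=
      Continuous.intervalIntegrable (by fun_prop) _ _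
    have i4 : IntervalIntegrable (fun s => kap * v (s - τ)) volume 0 t :=
      Continuous.intervalIntegrable (by fun_prop) _ _
    have hvt := hve t ht
    rw [intervalIntegral.integral_sub ((i1.sub i2).sub i3) i4,
      intervalIntegral.integral_sub (i1.sub i2) i3, intervalIntegral.integral_sub i1 i2,
      intervalIntegral.integral_neg, intervalIntegral.integral_const_mul,
      intervalIntegral.integral_const_mul, intervalIntegral.integral_const_mul,
      intervalIntegral.integral_const_mul, integral_comp_sub_delay hx, integral_comp_sub_delay hv]
      at hvt
    have h1 := hxe t ht
    have h2 := hxe (max (t - τ) 0) (le_max_right _ _)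
    rw [hEx ht]
    simp only [hX]
    linear_combination hvt + d * h1 + kap * h2
  set g : ℝ → ℝ := fun t => x t + (d * X t + lam * (∫ s in (0 : ℝ)..t, X s) +
    kap * X (max (t - τ) 0) + mu * ∫ s in (0 : ℝ)..(max (t - τ) 0), X s) with hg
  have hgc : Continuous g := by
    have h1 := hprim hXc 0
    have h2 : Continuous fun t => ∫ s in (0 : ℝ)..(max (t - τ) 0), X s :=
      h1.comp (by fun_prop : Continuous fun t : ℝ => max (t - τ) 0)
    fun_prop
  have hxg : ∀ s, 0 ≤ s → x s + ∫ u in (0 : ℝ)..s, delayKernel d lam mu kap τ (s - u) * x u = g s :=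
    fun s hs => by rw [integral_delayKernel_mul d lam mu kap hτ.le hx hs]
  have hgD {t : ℝ} (ht : 0 ≤ t) : g t = D₂ t + c * ∫ s in (0 : ℝ)..t, b s := by
    have hcx : Continuous fun s => ∫ u in (-τ)..(min (s - τ) 0), x u :=
      (hprim hx (-τ)).comp (by fun_prop : Continuous fun s : ℝ => min (s - τ) 0)
    have hcv : Continuous fun s => ∫ u in (-τ)..(min (s - τ) 0), v u :=
      (hprim hv (-τ)).comp (by fun_prop : Continuous fun s : ℝ => min (s - τ) 0)
    have hEi : IntervalIntegrable E volume 0 t := by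
      refine (Continuous.intervalIntegrable (?_ : Continuous fun s => v₀ 0 + d * x₀ 0 -
        mu * (∫ u in (-τ)..(min (s - τ) 0), x u) -
        kap * ((∫ u in (-τ)..(min (s - τ) 0), v u) - x₀ 0)) 0 t).congr fun s hs => ?_
      · fun_prop
      · rw [Set.uIoc_of_le ht] at hs
        exact (hEx hs.1.le).symm
    have i1 : IntervalIntegrable (fun s => lam * X s) volume 0 t :=
      Continuous.intervalIntegrable (by fun_prop) _ _
    have i2 : IntervalIntegrable (fun s => d * x s) volume 0 t :=
      Continuous.intervalIntegrable (by fun_prop) _ _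
    have i3 : IntervalIntegrable (fun s => mu * X (max (s - τ) 0)) volume 0 t :=
      Continuous.intervalIntegrable (by fun_prop) _ _
    have i4 : IntervalIntegrable (fun s => kap * x (max (s - τ) 0)) volume 0 t :=
      Continuous.intervalIntegrable (by fun_prop) _ _
    have i5 : IntervalIntegrable (fun s => c * b s) volume 0 t :=
      Continuous.intervalIntegrable (by fun_prop) _ _
    have hvi : ∫ s in (0 : ℝ)..t, v s = ∫ s in (0 : ℝ)..t, (E s - lam * X s - d * x s -
        mu * X (max (s - τ) 0) - kap * x (max (s - τ) 0) + c * b s) := by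
      refine intervalIntegral.integral_congr fun s hs => ?_
      rw [Set.uIcc_of_le ht] at hs
      exact hv2 hs.1
    rw [intervalIntegral.integral_add ((((hEi.sub i1).sub i2).sub i3).sub i4) i5,
      intervalIntegral.integral_sub (((hEi.sub i1).sub i2).sub i3) i4,
      intervalIntegral.integral_sub ((hEi.sub i1).sub i2) i3,
      intervalIntegral.integral_sub (hEi.sub i1) i2, intervalIntegral.integral_sub hEi i1,
      intervalIntegral.integral_const_mul, intervalIntegral.integral_const_mul,
      intervalIntegral.integral_const_mul, intervalIntegral.integral_const_mul,
      intervalIntegral.integral_const_mul] at hvi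
    have hdelay (f : ℝ → ℝ) (hf : Continuous f) : ∫ s in (0 : ℝ)..t, f (max (s - τ) 0) =
        f 0 * (min (t - τ) 0 + τ) + ∫ s in (0 : ℝ)..(max (t - τ) 0), f s := by
      rw [integral_comp_sub_delay (f := fun r => f (max r 0)) (by fun_prop)]
      congr 1
      · have hle : -τ ≤ min (t - τ) 0 := le_min (by linarith) (by linarith)
        have : ∫ s in (-τ)..(min (t - τ) 0), f (max s 0) = ∫ s in (-τ)..(min (t - τ) 0), f 0 := by
          refine intervalIntegral.integral_congr fun s hs => ?_
          rw [Set.uIcc_of_le hle] at hs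
          simp only [max_eq_right (hs.2.trans (min_le_right _ _))]
        rw [this, intervalIntegral.integral_const, smul_eq_mul]
        ring
      · refine intervalIntegral.integral_congr fun s hs => ?_
        rw [Set.uIcc_of_le (le_max_right _ _)] at hs
        simp only [max_eq_left hs.1]
    have hX0 : X 0 = 0 := by simp [hX]
    rw [hdelay X hXc, hdelay x hx, hX0, hx00] at hvi
    have hxt := hxe t ht
    simp only [hg, hD₂]
    simp only [hX] at hvi ⊢
    linear_combination hxt + hvi
  have hBc : Continuous fun t => ∫ s in (0 : ℝ)..t, b s := hprim hb 0
  set Y : ℝ → ℝ := fun t => ∫ s in (0 : ℝ)..t, Ψ (t - s) * b s with hY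
  have hYc : Continuous Y :=
    intervalIntegral.continuous_parametric_intervalIntegral_of_continuous
      (f := fun t s => Ψ (t - s) * b s) (by fun_prop) continuous_id
  have hfin {t : ℝ} (ht : 0 ≤ t) :
      ∫ s in (0 : ℝ)..t, Ψ (t - s) * D₂ s = X t - c * ∫ s in (0 : ℝ)..t, Y s := by
    have e1 : ∫ s in (0 : ℝ)..t, Ψ (t - s) * D₂ s =
        ∫ s in (0 : ℝ)..t, (Ψ (t - s) * g s - c * (Ψ (t - s) * ∫ u in (0 : ℝ)..s, b u)) := by
      refine intervalIntegral.integral_congr fun s hs => ?_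
      rw [Set.uIcc_of_le ht] at hs
      simp only [hgD hs.1]
      ring
    rw [e1, intervalIntegral.integral_sub (Continuous.intervalIntegrable (by fun_prop) _ _)
      (Continuous.intervalIntegrable (by fun_prop) _ _), intervalIntegral.integral_const_mul,
      integral_integral_comm_convolution hΨ hb ht,
      ← integral_eq_volterra_resolvent (measurable_delayKernel d lam mu kap τ)
        (abs_delayKernel_le d lam mu kap hτ.le) hΨ h hx hgc hxg ht]
  intro t ht
  have hder : HasDerivAt (fun t => X t - c * ∫ s in (0 : ℝ)..t, Y s) (x t - c * Y t) t :=
    (hx.integral_hasStrictDerivAt 0 t).hasDerivAt.sub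
      ((hYc.integral_hasStrictDerivAt 0 t).hasDerivAt.const_mul c)
  have hev : (fun t => ∫ s in (0 : ℝ)..t, Ψ (t - s) * D₂ s) =ᶠ[𝓝 t]
      fun t => X t - c * ∫ s in (0 : ℝ)..t, Y s := by
    filter_upwards [lt_mem_nhds ht] with s hs using hfin hs.le
  rw [hev.deriv_eq, hder.deriv]
  ring

/-! ### Time integrals of processes with continuous paths -/

theorem tendsto_floor_mul_div (s : ℝ) :
    Tendsto (fun N : ℕ => (⌊s * ((N : ℝ) + 1)⌋ : ℝ) / ((N : ℝ) + 1)) atTop (𝓝 s) := by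
  have h1 : Tendsto (fun N : ℕ => s - 1 / ((N : ℝ) + 1)) atTop (𝓝 s) := by
    simpa using (tendsto_const_nhds (x := s)).sub (tendsto_one_div_add_atTop_nhds_zero_nat (𝕜 := ℝ))
  refine tendsto_of_tendsto_of_tendsto_of_le_of_le h1 tendsto_const_nhds (fun N => ?_) fun N => ?_
  · have hN : (0 : ℝ) < (N : ℝ) + 1 := by positivity
    simp only
    rw [le_div_iff₀ hN, sub_mul, one_div, inv_mul_cancel₀ hN.ne']
    linarith [Int.lt_floor_add_one (s * ((N : ℝ) + 1))]
  · have hN : (0 : ℝ) < (N : ℝ) + 1 := by positivity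
    simp only
    rw [div_le_iff₀ hN]
    exact Int.floor_le _

/-- Joint measurability comes from piecewise constant approximation in time. Only countably many
grid times occur, so measurable versions can be chosen there off a single null set. -/
theorem aemeasurable_uncurry_of_continuous {Ω : Type*} [MeasurableSpace Ω] {P : Measure Ω}
    [SFinite P] (ν : Measure ℝ) [SFinite ν] {f : ℝ → Ω → ℝ} (hm : ∀ s, AEMeasurable (f s) P)
    (hc : ∀ᵐ x ∂P, Continuous fun s => f s x) :
    AEMeasurable (Function.uncurry f) (ν.prod P) := by
  set X : ℕ → ℝ × Ω → ℝ := fun N p =>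
    (hm ((⌊p.1 * ((N : ℝ) + 1)⌋ : ℝ) / ((N : ℝ) + 1))).mk _ p.2 with hX
  have hXm (N : ℕ) : Measurable (X N) := by
    have : Measurable fun q : ℤ × Ω => (hm ((q.1 : ℝ) / ((N : ℝ) + 1))).mk _ q.2 :=
      measurable_from_prod_countable_right fun m => (hm ((m : ℝ) / ((N : ℝ) + 1))).measurable_mk
    exact this.comp (f := fun p : ℝ × Ω => ((⌊p.1 * ((N : ℝ) + 1)⌋ : ℤ), p.2))
      ((Int.measurable_floor.comp (by fun_prop)).prodMk measurable_snd)
  refine aemeasurable_of_tendsto_metrizable_ae atTop (fun N => (hXm N).aemeasurable) ?_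
  have hgood : ∀ᵐ x ∂P, ∀ (m : ℤ) (N : ℕ),
      f ((m : ℝ) / ((N : ℝ) + 1)) x = (hm ((m : ℝ) / ((N : ℝ) + 1))).mk _ x :=
    ae_all_iff.2 fun m => ae_all_iff.2 fun N => (hm _).ae_eq_mk
  have := (Measure.quasiMeasurePreserving_snd (μ := ν) (ν := P)).ae (hgood.and hc)
  filter_upwards [this] with p hp
  simp only [hX, ← hp.1]
  exact (hp.2.tendsto p.1).comp (tendsto_floor_mul_div p.1)

section SecondMoment

variable {Ω : Type*} [MeasurableSpace Ω] {P : Measure Ω} [IsProbabilityMeasure P]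
  {ν : Measure ℝ} [IsFiniteMeasure ν] {Z : ℝ → Ω → ℝ}

theorem integrable_prod_mul_process (hZ : AEMeasurable (Function.uncurry Z) (ν.prod P))
    (hL : ∀ᵐ s ∂ν, MemLp (Z s) 2 P) {C : ℝ} (hC : ∀ᵐ s ∂ν, ∫ x, Z s x ^ 2 ∂P ≤ C) :
    Integrable (fun p : (ℝ × ℝ) × Ω => Z p.1.1 p.2 * Z p.1.2 p.2) ((ν.prod ν).prod P) := by
  have hm1 : AEMeasurable (fun p : (ℝ × ℝ) × Ω => Z p.1.1 p.2) ((ν.prod ν).prod P) :=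
    hZ.comp_quasiMeasurePreserving
      (MeasureTheory.QuasiMeasurePreserving.prodMap Measure.quasiMeasurePreserving_fst
        (Measure.QuasiMeasurePreserving.id P))
  have hm2 : AEMeasurable (fun p : (ℝ × ℝ) × Ω => Z p.1.2 p.2) ((ν.prod ν).prod P) :=
    hZ.comp_quasiMeasurePreserving
      (MeasureTheory.QuasiMeasurePreserving.prodMap Measure.quasiMeasurePreserving_snd
        (Measure.QuasiMeasurePreserving.id P))
  have hm := (hm1.mul hm2).aestronglyMeasurable
  have hL1 := (Measure.quasiMeasurePreserving_fst (μ := ν) (ν := ν)).ae (hL.and hC)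
  have hL2 := (Measure.quasiMeasurePreserving_snd (μ := ν) (ν := ν)).ae (hL.and hC)
  refine (integrable_prod_iff hm).2 ⟨?_, ?_⟩
  · filter_upwards [hL1, hL2] with p h1 h2
    exact h1.1.integrable_mul h2.1
  · refine Integrable.of_bound hm.norm.integral_prod_right' C ?_
    filter_upwards [hL1, hL2] with p h1 h2
    rw [Real.norm_of_nonneg (integral_nonneg fun x => norm_nonneg _)]
    have hi : Integrable (fun x => (Z p.1 x ^ 2 + Z p.2 x ^ 2) / 2) P :=
      (h1.1.integrable_sq.add h2.1.integrable_sq).div_const 2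
    calc ∫ x, ‖Z p.1 x * Z p.2 x‖ ∂P ≤ ∫ x, (Z p.1 x ^ 2 + Z p.2 x ^ 2) / 2 ∂P := by
          refine integral_mono (h1.1.integrable_mul h2.1).norm hi fun x => ?_
          simp only
          rw [norm_mul, Real.norm_eq_abs, Real.norm_eq_abs, ← sq_abs (Z p.1 x), ← sq_abs (Z p.2 x)]
          nlinarith [sq_nonneg (|Z p.1 x| - |Z p.2 x|)]
      _ ≤ C := by
          rw [integral_div, integral_add h1.1.integrable_sq h2.1.integrable_sq]
          linarith [h1.2, h2.2]

theorem integrable_uncurry_process (hZ : AEMeasurable (Function.uncurry Z) (ν.prod P))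
    (hL : ∀ᵐ s ∂ν, MemLp (Z s) 2 P) {C : ℝ} (hC : ∀ᵐ s ∂ν, ∫ x, Z s x ^ 2 ∂P ≤ C) :
    Integrable (Function.uncurry Z) (ν.prod P) := by
  have hm := hZ.aestronglyMeasurable
  refine (integrable_prod_iff hm).2 ⟨?_, ?_⟩
  · filter_upwards [hL] with s h1 using h1.integrable one_le_two
  · refine Integrable.of_bound hm.norm.integral_prod_right' (1 + C) ?_
    filter_upwards [hL, hC] with s h1 h2
    rw [Real.norm_of_nonneg (integral_nonneg fun x => norm_nonneg _)]
    calc ∫ x, ‖Z s x‖ ∂P ≤ ∫ x, (1 + Z s x ^ 2) ∂P := by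
          refine integral_mono (h1.integrable one_le_two).norm
            ((integrable_const 1).add h1.integrable_sq) fun x => ?_
          simp only
          rw [Real.norm_eq_abs, ← sq_abs (Z s x)]
          nlinarith [sq_nonneg (|Z s x| - 1), abs_nonneg (Z s x)]
      _ ≤ 1 + C := by
          rw [integral_add (integrable_const 1) h1.integrable_sq]
          simpa using h2

theorem memLp_integral_process (hZ : AEMeasurable (Function.uncurry Z) (ν.prod P))
    (hL : ∀ᵐ s ∂ν, MemLp (Z s) 2 P) {C : ℝ} (hC : ∀ᵐ s ∂ν, ∫ x, Z s x ^ 2 ∂P ≤ C) :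
    MemLp (fun x => ∫ s, Z s x ∂ν) 2 P := by
  have hi := (integrable_prod_mul_process hZ hL hC).integral_prod_right
  have hY := (integrable_uncurry_process hZ hL hC).integral_prod_right
  refine (memLp_two_iff_integrable_sq hY.aestronglyMeasurable).2 (hi.congr (.of_forall fun x => ?_))
  simp only [integral_prod_mul (fun s => Z s x) (fun s => Z s x), Function.uncurry]
  ring

/-- The square of the time integral is a double time integral, and Fubini moves the expectation
inside. The uniform second-moment bound gives integrability. -/
theorem variance_integral_process (hZ : AEMeasurable (Function.uncurry Z) (ν.prod P))
    (hL : ∀ᵐ s ∂ν, MemLp (Z s) 2 P) {C : ℝ} (hC : ∀ᵐ s ∂ν, ∫ x, Z s x ^ 2 ∂P ≤ C)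
    (h0 : ∀ᵐ s ∂ν, ∫ x, Z s x ∂P = 0) :
    variance (fun x => ∫ s, Z s x ∂ν) P = ∫ s, ∫ u, ∫ x, Z s x * Z u x ∂P ∂ν ∂ν := by
  have hi := integrable_prod_mul_process hZ hL hC
  have hY := integrable_uncurry_process hZ hL hC
  have hmean : ∫ x, ∫ s, Z s x ∂ν ∂P = 0 := by
    rw [← integral_integral_swap hY, integral_congr_ae h0]
    simp
  rw [variance_of_integral_eq_zero
    (memLp_integral_process hZ hL hC).aestronglyMeasurable.aemeasurable hmean]
  have e : ∀ x, (∫ s, Z s x ∂ν) ^ 2 = ∫ p, Z p.1 x * Z p.2 x ∂(ν.prod ν) := fun x => by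
    rw [integral_prod_mul (fun s => Z s x) (fun s => Z s x), sq]
  simp only [e]
  rw [← integral_integral_swap (f := fun (p : ℝ × ℝ) x => Z p.1 x * Z p.2 x) hi,
    integral_prod _ hi.integral_prod_left]

end SecondMoment

/-! ### The variance of a linear functional of Brownian motion -/

/-- `min s u` is the length of the set of `r` in `[0, s]` with `r ≤ u`. Exchanging the integrals
over `u` and `r` gives the right-hand side. -/
theorem integral_mul_min {g : ℝ → ℝ} (hg : Continuous g) {s t : ℝ} (hs : 0 ≤ s) (hst : s ≤ t) :
    ∫ u in (0 : ℝ)..t, g u * min s u = ∫ r in (0 : ℝ)..s, ∫ u in r..t, g u := by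
  have hi (a b : ℝ) : IntervalIntegrable (fun u => g u * min s u) volume a b :=
    Continuous.intervalIntegrable (by fun_prop) _ _
  obtain ⟨B, hB0, hB⟩ := exists_bound_Icc hg s
  have e1 : ∫ r in (0 : ℝ)..s, ∫ u in r..t, g u =
      ∫ r in (0 : ℝ)..s, ((∫ u in r..s, g u) + ∫ u in s..t, g u) := by
    congr 1 with r
    exact (intervalIntegral.integral_add_adjacent_intervals (hg.intervalIntegrable _ _)
      (hg.intervalIntegrable _ _)).symm
  have hc : Continuous fun r => ∫ u in r..s, g u := by
    simp only [intervalIntegral.integral_symm s]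
    exact (intervalIntegral.continuous_primitive (fun _ _ => hg.intervalIntegrable _ _) s).neg
  have e2 : ∫ r in (0 : ℝ)..s, ∫ u in r..s, g u = ∫ u in (0 : ℝ)..s, g u * u := by
    rw [← integral_integral_triangle (F := fun u _ => g u) (C := B) hs
      (hg.measurable.comp measurable_fst) fun u r hr hru hus => hB u ⟨hr.trans hru, hus⟩]
    congr 1 with u
    simp [mul_comm]
  rw [e1, intervalIntegral.integral_add (hc.intervalIntegrable _ _) (by simp), e2,
    ← intervalIntegral.integral_add_adjacent_intervals (hi 0 s) (hi s t)]
  congr 1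
  · refine intervalIntegral.integral_congr fun u hu => ?_
    rw [Set.uIcc_of_le hs] at hu
    simp only [min_eq_right hu.2]
  · rw [intervalIntegral.integral_const, sub_zero, smul_eq_mul, mul_comm,
      ← intervalIntegral.integral_mul_const]
    refine intervalIntegral.integral_congr fun u hu => ?_
    rw [Set.uIcc_of_le hst] at hu
    simp only [min_eq_left hu.1]

/-- This replaces the Itô isometry: the left side is the variance of `∫ g ξ` for a Brownian motion
`ξ`, the right side that of the same functional after integration by parts. -/
theorem integral_integral_mul_min {g : ℝ → ℝ} (hg : Continuous g) {t : ℝ} (ht : 0 ≤ t) :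
    ∫ s in (0 : ℝ)..t, ∫ u in (0 : ℝ)..t, g s * g u * min s u =
      ∫ r in (0 : ℝ)..t, (∫ u in r..t, g u) ^ 2 := by
  set G : ℝ → ℝ := fun r => ∫ u in r..t, g u with hG
  have hGc : Continuous G := by
    simp only [hG, intervalIntegral.integral_symm t]
    exact (intervalIntegral.continuous_primitive (fun _ _ => hg.intervalIntegrable _ _) t).neg
  obtain ⟨A, hA0, hA⟩ := exists_bound_Icc hg t
  obtain ⟨B, hB0, hB⟩ := exists_bound_Icc hGc t
  have e1 : ∫ s in (0 : ℝ)..t, ∫ u in (0 : ℝ)..t, g s * g u * min s u =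
      ∫ s in (0 : ℝ)..t, ∫ r in (0 : ℝ)..s, g s * G r := by
    refine intervalIntegral.integral_congr fun s hs => ?_
    rw [Set.uIcc_of_le ht] at hs
    simp only [mul_assoc, intervalIntegral.integral_const_mul]
    rw [integral_mul_min hg hs.1 hs.2]
  rw [e1, integral_integral_triangle (F := fun s r => g s * G r) (C := A * B) ht
    (by exact Continuous.measurable (by fun_prop)) fun s r hr hrs hst => by
      rw [abs_mul]
      exact mul_le_mul (hA s ⟨hr.trans hrs, hst⟩) (hB r ⟨hr, hrs.trans hst⟩) (abs_nonneg _) hA0]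
  congr 1 with r
  rw [intervalIntegral.integral_mul_const, sq]

section Brownian

variable {n : ℕ} {Ω : Type*} [MeasurableSpace Ω] {P : Measure Ω}
  {ξ : Fin n → ℝ≥0 → Ω → ℝ}

theorem memLp_two_brownian (hξ : ∀ m, IsBrownianReal (ξ m) P) (m : Fin n) (s : ℝ≥0) :
    MemLp (ξ m s) 2 P :=
  ((hξ m).hasLaw_eval s).hasGaussianLaw.memLp (by simp)

/-- The Brownian motions in the coordinates given by the columns of `Q`. -/
def modalNoise (Q : Matrix (Fin n) (Fin n) ℝ) (ξ : Fin n → ℝ≥0 → Ω → ℝ) (l : Fin n) (s : ℝ)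
    (x : Ω) : ℝ :=
  ∑ m, Q m l * ξ m s.toNNReal x

variable {Q : Matrix (Fin n) (Fin n) ℝ}

theorem memLp_two_modalNoise (hξ : ∀ m, IsBrownianReal (ξ m) P) (l : Fin n) (s : ℝ) :
    MemLp (modalNoise Q ξ l s) 2 P :=
  memLp_finsetSum _ fun m _ => (memLp_two_brownian hξ m _).const_mul (Q m l)

theorem ae_continuous_modalNoise (hξ : ∀ m, IsBrownianReal (ξ m) P) :
    ∀ᵐ x ∂P, ∀ l, Continuous fun s => modalNoise Q ξ l s x := by
  have : ∀ᵐ x ∂P, ∀ m, Continuous fun t => ξ m t x := ae_all_iff.2 fun m => (hξ m).cont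
  filter_upwards [this] with x hx l
  refine continuous_finsetSum _ fun m _ => continuous_const.mul ?_
  exact (hx m).comp continuous_real_toNNReal

variable [IsProbabilityMeasure P]

theorem integral_brownian_mul_brownian (hξ : ∀ m, IsBrownianReal (ξ m) P)
    (hind : iIndepFun (fun m x (t : ℝ≥0) => ξ m t x) P) (m m' : Fin n) (s u : ℝ≥0) :
    ∫ x, ξ m s x * ξ m' u x ∂P = if m = m' then ((min s u : ℝ≥0) : ℝ) else 0 := by
  split_ifs with h
  · subst h
    have := covariance_eq_sub (memLp_two_brownian hξ m s) (memLp_two_brownian hξ m u)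
    rw [(hξ m).covariance_eval, (hξ m).integral_eval] at this
    simpa using this.symm
  · have hi : IndepFun (ξ m s) (ξ m' u) P :=
      (hind.indepFun h).comp (measurable_pi_apply s) (measurable_pi_apply u)
    rw [hi.integral_fun_mul_eq_mul_integral (memLp_two_brownian hξ m s).aestronglyMeasurable
      (memLp_two_brownian hξ m' u).aestronglyMeasurable, (hξ m).integral_eval]
    simp

theorem integral_modalNoise (hξ : ∀ m, IsBrownianReal (ξ m) P) (l : Fin n) (s : ℝ) :
    ∫ x, modalNoise Q ξ l s x ∂P = 0 := by
  simp only [modalNoise]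
  rw [integral_finsetSum _ fun m _ =>
    ((memLp_two_brownian hξ m _).integrable one_le_two).const_mul (Q m l)]
  simp [integral_const_mul, fun m => (hξ m).integral_eval]

/-- Orthonormality of the columns of `Q` preserves the covariance structure, so distinct modal
noises are uncorrelated. Their independence is not needed for variances. -/
theorem integral_modalNoise_mul_modalNoise (hQ : Q ∈ Matrix.orthogonalGroup (Fin n) ℝ)
    (hξ : ∀ m, IsBrownianReal (ξ m) P)
    (hind : iIndepFun (fun m x (t : ℝ≥0) => ξ m t x) P) (l l' : Fin n) {s u : ℝ} (hs : 0 ≤ s)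
    (hu : 0 ≤ u) :
    ∫ x, modalNoise Q ξ l s x * modalNoise Q ξ l' u x ∂P = if l = l' then min s u else 0 := by
  have hi (m m' : Fin n) : Integrable
      (fun x => Q m l * ξ m s.toNNReal x * (Q m' l' * ξ m' u.toNNReal x)) P :=
    ((memLp_two_brownian hξ m _).const_mul (Q m l)).integrable_mul
      ((memLp_two_brownian hξ m' _).const_mul (Q m' l'))
  have hcol : ∑ m, Q m l * Q m l' = if l = l' then 1 else 0 := by
    have := congrFun (congrFun ((Matrix.mem_orthogonalGroup_iff' _ _).1 hQ) l) l'
    simpa [Matrix.mul_apply, Matrix.one_apply] using this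
  simp only [modalNoise, Finset.sum_mul_sum]
  rw [integral_finsetSum _ fun m _ => integrable_finsetSum _ fun m' _ => hi m m']
  have e (m m' : Fin n) : ∫ x, Q m l * ξ m s.toNNReal x * (Q m' l' * ξ m' u.toNNReal x) ∂P =
      Q m l * Q m' l' * if m = m' then min s u else 0 := by
    have : ∀ x, Q m l * ξ m s.toNNReal x * (Q m' l' * ξ m' u.toNNReal x) =
      Q m l * Q m' l' * (ξ m s.toNNReal x * ξ m' u.toNNReal x) := fun x => by ring
    simp only [this]
    rw [integral_const_mul, integral_brownian_mul_brownian hξ hind]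
    simp [NNReal.coe_min, hs, hu]
  have e' (m : Fin n) : ∫ x, ∑ m', Q m l * ξ m s.toNNReal x * (Q m' l' * ξ m' u.toNNReal x) ∂P =
      Q m l * Q m l' * min s u := by
    rw [integral_finsetSum _ fun m' _ => hi m m']
    simp [e]
  simp only [e']
  rw [← Finset.sum_mul, hcol]
  split_ifs <;> simp

variable {Ψ : Fin n → ℝ → ℝ}

/-- The cross terms between modes vanish. Within a mode, `integral_integral_mul_min` applied to `Ψ(t
- ·)` leaves the squared primitive of `Ψ`, after reversing time. -/
theorem memLp_and_variance_modal_integral (hQ : Q ∈ Matrix.orthogonalGroup (Fin n) ℝ)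
    (hξ : ∀ m, IsBrownianReal (ξ m) P)
    (hind : iIndepFun (fun m x (t : ℝ≥0) => ξ m t x) P)
    (hΨ : ∀ l, Continuous (Ψ l)) (a : Fin n → ℝ) {t : ℝ} (ht : 0 ≤ t) :
    MemLp (fun x => ∑ l, a l * ∫ s in (0 : ℝ)..t, Ψ l (t - s) * modalNoise Q ξ l s x) 2 P ∧
    variance (fun x => ∑ l, a l * ∫ s in (0 : ℝ)..t, Ψ l (t - s) * modalNoise Q ξ l s x) P =
      ∑ l, a l ^ 2 * ∫ s in (0 : ℝ)..t, (∫ u in (0 : ℝ)..s, Ψ l u) ^ 2 := by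
  set Z : ℝ → Ω → ℝ := fun s x => ∑ l, a l * Ψ l (t - s) * modalNoise Q ξ l s x with hZdef
  set ν : Measure ℝ := volume.restrict (Set.Ioc 0 t) with hν
  have hZL (s : ℝ) : MemLp (Z s) 2 P :=
    memLp_finsetSum _ fun l _ => (memLp_two_modalNoise hξ l s).const_mul (a l * Ψ l (t - s))
  have hZm : AEMeasurable (Function.uncurry Z) (ν.prod P) := by
    refine aemeasurable_uncurry_of_continuous ν
      (fun s => (hZL s).aestronglyMeasurable.aemeasurable) ?_
    filter_upwards [ae_continuous_modalNoise (Q := Q) hξ] with x hx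
    simp only [hZdef]
    fun_prop
  have hae : (fun x => ∑ l, a l * ∫ s in (0 : ℝ)..t, Ψ l (t - s) * modalNoise Q ξ l s x) =ᵐ[P]
      fun x => ∫ s, Z s x ∂ν := by
    filter_upwards [ae_continuous_modalNoise (Q := Q) hξ] with x hx
    rw [hν, ← intervalIntegral.integral_of_le ht]
    simp only [hZdef]
    rw [intervalIntegral.integral_finsetSum fun l _ =>
      Continuous.intervalIntegrable (by fun_prop) _ _]
    simp only [← intervalIntegral.integral_const_mul, mul_assoc]
  have hcov {s u : ℝ} (hs : 0 ≤ s) (hu : 0 ≤ u) : ∫ x, Z s x * Z u x ∂P =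
      ∑ l, a l ^ 2 * (Ψ l (t - s) * Ψ l (t - u) * min s u) := by
    have hi (l l' : Fin n) : Integrable (fun x => a l * Ψ l (t - s) * modalNoise Q ξ l s x *
        (a l' * Ψ l' (t - u) * modalNoise Q ξ l' u x)) P :=
      ((memLp_two_modalNoise hξ l s).const_mul _).integrable_mul
        ((memLp_two_modalNoise hξ l' u).const_mul _)
    simp only [hZdef, Finset.sum_mul_sum]
    rw [integral_finsetSum _ fun l _ => integrable_finsetSum _ fun l' _ => hi l l']
    refine Finset.sum_congr rfl fun l _ => ?_
    rw [integral_finsetSum _ fun l' _ => hi l l']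
    have e (l' : Fin n) : ∫ x, a l * Ψ l (t - s) * modalNoise Q ξ l s x *
        (a l' * Ψ l' (t - u) * modalNoise Q ξ l' u x) ∂P =
        a l * Ψ l (t - s) * (a l' * Ψ l' (t - u)) * if l = l' then min s u else 0 := by
      rw [← integral_modalNoise_mul_modalNoise hQ hξ hind l l' hs hu, ← integral_const_mul]
      congr 1 with x
      ring
    simp only [e, mul_ite, mul_zero, Finset.sum_ite_eq, Finset.mem_univ, if_true]
    ring
  have hmem : ∀ᵐ s ∂ν, s ∈ Set.Ioc 0 t := ae_restrict_mem measurableSet_Ioc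
  obtain ⟨C, -, hC⟩ := exists_bound_Icc (k := fun s =>
    ∑ l, a l ^ 2 * (Ψ l (t - s) * Ψ l (t - s) * min s s)) (by fun_prop) t
  have hZC : ∀ᵐ s ∂ν, ∫ x, Z s x ^ 2 ∂P ≤ C := by
    filter_upwards [hmem] with s hs
    simp only [sq (Z s _)]
    rw [hcov hs.1.le hs.1.le]
    exact (le_abs_self _).trans (hC s ⟨hs.1.le, hs.2⟩)
  have hZ0 : ∀ᵐ s ∂ν, ∫ x, Z s x ∂P = 0 := by
    refine .of_forall fun s => ?_
    simp only [hZdef]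
    rw [integral_finsetSum _ fun l _ =>
      ((memLp_two_modalNoise hξ l s).integrable one_le_two).const_mul _]
    simp [integral_const_mul, integral_modalNoise hξ]
  refine ⟨(memLp_congr_ae hae).2 (memLp_integral_process hZm (.of_forall hZL) hZC), ?_⟩
  rw [variance_congr hae, variance_integral_process hZm (.of_forall hZL) hZC hZ0]
  have e1 : ∫ s, ∫ u, ∫ x, Z s x * Z u x ∂P ∂ν ∂ν = ∫ s in (0 : ℝ)..t, ∫ u in (0 : ℝ)..t,
      ∑ l, a l ^ 2 * (Ψ l (t - s) * Ψ l (t - u) * min s u) := by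
    rw [intervalIntegral.integral_of_le ht]
    refine setIntegral_congr_fun measurableSet_Ioc fun s hs => ?_
    rw [intervalIntegral.integral_of_le ht]
    exact setIntegral_congr_fun measurableSet_Ioc fun u hu => hcov hs.1.le hu.1.le
  have e2 (s : ℝ) : ∫ u in (0 : ℝ)..t, ∑ l, a l ^ 2 * (Ψ l (t - s) * Ψ l (t - u) * min s u) =
      ∑ l, a l ^ 2 * ∫ u in (0 : ℝ)..t, Ψ l (t - s) * Ψ l (t - u) * min s u := by
    rw [intervalIntegral.integral_finsetSum fun l _ =>
      Continuous.intervalIntegrable (by fun_prop) _ _]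
    simp only [intervalIntegral.integral_const_mul]
  rw [e1]
  simp only [e2]
  rw [intervalIntegral.integral_finsetSum fun l _ => ?_]
  · refine Finset.sum_congr rfl fun l _ => ?_
    rw [intervalIntegral.integral_const_mul,
      integral_integral_mul_min (g := fun s => Ψ l (t - s)) (by fun_prop) ht]
    simp only [intervalIntegral.integral_comp_sub_left (fun s => Ψ l s), sub_self]
    rw [intervalIntegral.integral_comp_sub_left (fun r => (∫ u in (0 : ℝ)..r, Ψ l u) ^ 2)]
    simp
  · refine Continuous.intervalIntegrable (continuous_const.mul ?_) _ _
    exact intervalIntegral.continuous_parametric_intervalIntegral_of_continuous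
      (f := fun s u => Ψ l (t - s) * Ψ l (t - u) * min s u) (by fun_prop) continuous_const

end Brownian

/-! ### Orthogonal diagonalization -/

namespace DiagonalizedBy

variable {n : ℕ} {A Q : Matrix (Fin n) (Fin n) ℝ} {a : Fin n → ℝ}

theorem transpose_mul_self (h : DiagonalizedBy A Q a) : Qᵀ * Q = 1 :=
  (Matrix.mem_orthogonalGroup_iff' _ _).1 h.1

theorem mul_transpose_self (h : DiagonalizedBy A Q a) : Q * Qᵀ = 1 :=
  (Matrix.mem_orthogonalGroup_iff _ _).1 h.1

theorem sum_col_mul_col (h : DiagonalizedBy A Q a) (l l' : Fin n) :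
    ∑ m, Q m l * Q m l' = if l = l' then 1 else 0 := by
  simpa [Matrix.mul_apply, Matrix.one_apply] using congrFun (congrFun h.transpose_mul_self l) l'

theorem sum_row_mul_row (h : DiagonalizedBy A Q a) (i j : Fin n) :
    ∑ l, Q i l * Q j l = if i = j then 1 else 0 := by
  simpa [Matrix.mul_apply, Matrix.one_apply] using congrFun (congrFun h.mul_transpose_self i) j

theorem mul_eq (h : DiagonalizedBy A Q a) : A * Q = Q * Matrix.diagonal a := by
  rw [h.2, Matrix.mul_assoc, h.transpose_mul_self, Matrix.mul_one]

theorem transpose_mul_eq (h : DiagonalizedBy A Q a) : Qᵀ * A = Matrix.diagonal a * Qᵀ := by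
  rw [h.2, ← Matrix.mul_assoc, ← Matrix.mul_assoc, h.transpose_mul_self, Matrix.one_mul]

theorem mulVec_col (h : DiagonalizedBy A Q a) (l : Fin n) :
    A *ᵥ (fun m => Q m l) = fun m => a l * Q m l := by
  ext m
  have := congrFun (congrFun h.mul_eq m) l
  rw [Matrix.mul_diagonal, Matrix.mul_apply] at this
  rw [mul_comm (a l), ← this]
  rfl

theorem sum_col_mul_mulVec (h : DiagonalizedBy A Q a) (l : Fin n) (y : Fin n → ℝ) :
    ∑ m, Q m l * (A *ᵥ y) m = a l * ∑ m, Q m l * y m := by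
  have : Qᵀ *ᵥ (A *ᵥ y) = Matrix.diagonal a *ᵥ (Qᵀ *ᵥ y) := by
    rw [Matrix.mulVec_mulVec, h.transpose_mul_eq, Matrix.mulVec_mulVec]
  have := congrFun this l
  rw [Matrix.mulVec_diagonal] at this
  simpa [Matrix.mulVec, dotProduct] using this

theorem sum_row_mul_modal (h : DiagonalizedBy A Q a) (y : Fin n → ℝ) (i : Fin n) :
    y i = ∑ l, Q i l * ∑ m, Q m l * y m := by
  have : Q *ᵥ (Qᵀ *ᵥ y) = y := by
    rw [Matrix.mulVec_mulVec, h.mul_transpose_self, Matrix.one_mulVec]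
  conv_lhs => rw [← this]
  simp [Matrix.mulVec, dotProduct]

/-- Functions of a diagonalizable matrix do not depend on the diagonalizing basis. -/
theorem functional_calculus_eq {U : Matrix (Fin n) (Fin n) ℝ} (hU : DiagonalizedBy A U a)
    (hQ : DiagonalizedBy A Q a) (φ : ℝ → ℝ) :
    U * Matrix.diagonal (φ ∘ a) * Uᵀ = Q * Matrix.diagonal (φ ∘ a) * Qᵀ := by
  set V := Uᵀ * Q with hV
  have hcomm : Matrix.diagonal a * V = V * Matrix.diagonal a := by
    rw [hV, ← Matrix.mul_assoc, ← hU.transpose_mul_eq, Matrix.mul_assoc, hQ.mul_eq,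
      Matrix.mul_assoc]
  -- Commuting with `diagonal a` means that `V l k` vanishes unless `a l = a k`. This property is
  -- inherited by `φ ∘ a`.
  have hφ : Matrix.diagonal (φ ∘ a) * V = V * Matrix.diagonal (φ ∘ a) := by
    ext l k
    have := congrFun (congrFun hcomm l) k
    rw [Matrix.diagonal_mul, Matrix.mul_diagonal] at this ⊢
    by_cases h : V l k = 0
    · simp [h]
    · have : a l = a k := mul_right_cancel₀ h (this.trans (mul_comm _ _))
      simp only [Function.comp, this]
      ring
  calc U * Matrix.diagonal (φ ∘ a) * Uᵀ = U * Matrix.diagonal (φ ∘ a) * (Uᵀ * (Q * Qᵀ)) := by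
        rw [hQ.mul_transpose_self, Matrix.mul_one]
    _ = U * (Matrix.diagonal (φ ∘ a) * V) * Qᵀ := by simp only [hV, Matrix.mul_assoc]
    _ = (U * Uᵀ) * (Q * Matrix.diagonal (φ ∘ a) * Qᵀ) := by
        rw [hφ]; simp only [hV, Matrix.mul_assoc]
    _ = _ := by rw [hU.mul_transpose_self, Matrix.one_mul]

/-- Both sums are the quadratic form of `φ(A)` at the difference of the basis vectors `e_i` and
`e_j`. -/
theorem sum_sub_sq_mul_eq {U : Matrix (Fin n) (Fin n) ℝ} (hU : DiagonalizedBy A U a)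
    (hQ : DiagonalizedBy A Q a) (φ : ℝ → ℝ) (i j : Fin n) :
    ∑ l, (U i l - U j l) ^ 2 * φ (a l) = ∑ l, (Q i l - Q j l) ^ 2 * φ (a l) := by
  have hent (R : Matrix (Fin n) (Fin n) ℝ) (i j : Fin n) :
      (R * Matrix.diagonal (φ ∘ a) * Rᵀ) i j = ∑ l, R i l * φ (a l) * R j l := by
    rw [Matrix.mul_apply]
    simp [Matrix.mul_diagonal]
  have hexp (R : Matrix (Fin n) (Fin n) ℝ) : ∑ l, (R i l - R j l) ^ 2 * φ (a l) =
      (R * Matrix.diagonal (φ ∘ a) * Rᵀ) i i - 2 * (R * Matrix.diagonal (φ ∘ a) * Rᵀ) i j +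
        (R * Matrix.diagonal (φ ∘ a) * Rᵀ) j j := by
    simp only [hent, Finset.mul_sum]
    rw [← Finset.sum_sub_distrib, ← Finset.sum_add_distrib]
    exact Finset.sum_congr rfl fun l _ => by ring
  rw [hexp, hexp, functional_calculus_eq hU hQ]

end DiagonalizedBy

/-! ### The spectrum of the Laplacian -/

namespace PowerNetwork

variable {n : ℕ} (N : PowerNetwork n)

theorem L_mulVec_apply (y : Fin n → ℝ) (i : Fin n) :
    (N.L *ᵥ y) i = ∑ j, N.weight i j * (y i - y j) := by
  rw [L, Matrix.sub_mulVec, Pi.sub_apply, Matrix.mulVec_diagonal]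
  simp only [Matrix.mulVec, dotProduct, mul_sub, Finset.sum_sub_distrib, Finset.sum_mul]

theorem two_mul_quadForm (y : Fin n → ℝ) :
    2 * ∑ i, y i * (N.L *ᵥ y) i = ∑ i, ∑ j, N.weight i j * (y i - y j) ^ 2 := by
  have h1 : ∑ i, y i * (N.L *ᵥ y) i = ∑ i, ∑ j, N.weight i j * (y i * (y i - y j)) := by
    refine Finset.sum_congr rfl fun i _ => ?_
    rw [L_mulVec_apply, Finset.mul_sum]
    exact Finset.sum_congr rfl fun j _ => by ring
  have h2 : ∑ i, ∑ j, N.weight i j * (y i * (y i - y j)) =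
      ∑ i, ∑ j, N.weight i j * (y j * (y j - y i)) := by
    rw [Finset.sum_comm]
    exact Finset.sum_congr rfl fun i _ => Finset.sum_congr rfl fun j _ => by
      rw [N.weight_symm]
  rw [two_mul, h1]
  nth_rewrite 2 [h2]
  rw [← Finset.sum_add_distrib]
  refine Finset.sum_congr rfl fun i _ => ?_
  rw [← Finset.sum_add_distrib]
  exact Finset.sum_congr rfl fun j _ => by ring

/-- A vanishing Dirichlet form makes `y` constant along every edge, and any two vertices are joined
by a walk. -/
theorem eq_of_quadForm_eq_zero {y : Fin n → ℝ} (h : ∑ i, y i * (N.L *ᵥ y) i = 0) (i j : Fin n) :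
    y i = y j := by
  have hsum := N.two_mul_quadForm y
  rw [h, mul_zero] at hsum
  have hnn (i j : Fin n) : 0 ≤ N.weight i j * (y i - y j) ^ 2 :=
    mul_nonneg (N.weight_nonneg i j) (sq_nonneg _)
  have hz (i j : Fin n) : N.weight i j * (y i - y j) ^ 2 = 0 := by
    have h1 := (Finset.sum_eq_zero_iff_of_nonneg
      (fun i _ => Finset.sum_nonneg fun j _ => hnn i j)).1 hsum.symm i (Finset.mem_univ _)
    exact (Finset.sum_eq_zero_iff_of_nonneg (fun j _ => hnn i j)).1 h1 j (Finset.mem_univ _)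
  have hw {i j : Fin n} (hij : 0 < N.weight i j) : y i = y j := by
    have := (mul_eq_zero.1 (hz i j)).resolve_left hij.ne'
    exact sub_eq_zero.1 (pow_eq_zero_iff two_ne_zero |>.1 this)
  obtain ⟨p⟩ := N.connected.preconnected i j
  induction p with
  | nil => rfl
  | cons hadj _ ih =>
    refine Eq.trans ?_ ih
    rw [SimpleGraph.fromRel_adj] at hadj
    rcases hadj.2 with h' | h'
    · exact hw h'
    · exact (hw h').symm

variable {N} {U : Matrix (Fin n) (Fin n) ℝ} {lam : Fin n → ℝ}

theorem quadForm_col (hL : DiagonalizedBy N.L U lam) (l : Fin n) :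
    ∑ i, U i l * (N.L *ᵥ fun m => U m l) i = lam l := by
  rw [hL.mulVec_col]
  have := hL.sum_col_mul_col l l
  rw [if_pos rfl] at this
  calc ∑ i, U i l * (lam l * U i l) = lam l * ∑ i, U i l * U i l := by
        rw [Finset.mul_sum]
        exact Finset.sum_congr rfl fun i _ => by ring
    _ = lam l := by rw [this, mul_one]

theorem eigenvalue_nonneg (hL : DiagonalizedBy N.L U lam) (l : Fin n) : 0 ≤ lam l := by
  have := N.two_mul_quadForm fun m => U m l
  rw [quadForm_col hL] at this
  have h0 : 0 ≤ ∑ i, ∑ j, N.weight i j * (U i l - U j l) ^ 2 :=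
    Finset.sum_nonneg fun i _ => Finset.sum_nonneg fun j _ =>
      mul_nonneg (N.weight_nonneg i j) (sq_nonneg _)
  linarith

theorem col_eq_of_eigenvalue_eq_zero (hL : DiagonalizedBy N.L U lam) {l : Fin n} (hl : lam l = 0)
    (i j : Fin n) : U i l = U j l :=
  N.eq_of_quadForm_eq_zero (y := fun m => U m l) ((quadForm_col hL l).trans hl) i j

/-- The constant vector lies in the kernel of `L`. Without a zero eigenvalue all its modal
coordinates would vanish. -/
theorem exists_eigenvalue_eq_zero (hL : DiagonalizedBy N.L U lam) (i : Fin n) :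
    ∃ l, lam l = 0 := by
  by_contra! hne
  have h1 : N.L *ᵥ (fun _ => (1 : ℝ)) = 0 := by
    ext i
    simp [L_mulVec_apply]
  have h2 (l : Fin n) : ∑ m, U m l * (1 : ℝ) = 0 := by
    have := hL.sum_col_mul_mulVec l (fun _ => (1 : ℝ))
    rw [h1] at this
    simp only [Pi.zero_apply, mul_zero, Finset.sum_const_zero] at this
    exact (mul_eq_zero.1 this.symm).resolve_left (hne l)
  have := hL.sum_row_mul_modal (fun _ => (1 : ℝ)) i
  simp only [h2] at this
  simp at this

theorem eigenvalue_zero_eq_zero (hlam : Monotone lam) (hL : DiagonalizedBy N.L U lam) {l₀ : Fin n}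
    (h₀ : l₀.val = 0) : lam l₀ = 0 := by
  obtain ⟨l, hl⟩ := exists_eigenvalue_eq_zero hL l₀
  refine le_antisymm ?_ (eigenvalue_nonneg hL l₀)
  rw [← hl]
  exact hlam (Fin.le_def.2 (by omega))

theorem eigenvalue_pos (hlam : Monotone lam) (hL : DiagonalizedBy N.L U lam) {l : Fin n}
    (hl : l.val ≠ 0) : 0 < lam l := by
  refine lt_of_le_of_ne (eigenvalue_nonneg hL l) fun h => ?_
  set l₀ : Fin n := ⟨0, l.pos⟩
  have hne : l₀ ≠ l := fun h' => hl (by rw [← h'])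
  have hl₀ : lam l₀ = 0 := eigenvalue_zero_eq_zero hlam hL rfl
  have c1 := fun i => col_eq_of_eigenvalue_eq_zero hL hl₀ i l₀
  have c2 := fun i => col_eq_of_eigenvalue_eq_zero hL h.symm i l₀
  have o1 := hL.sum_col_mul_col l₀ l
  have o2 := hL.sum_col_mul_col l₀ l₀
  have o3 := hL.sum_col_mul_col l l
  simp only [c1, c2, if_neg hne, if_pos, Finset.sum_const, nsmul_eq_mul, Finset.card_univ,
    Fintype.card_fin] at o1 o2 o3
  -- A second zero eigenvalue would give two constant columns. The product of their squared norms is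
  -- the square of their inner product, so it would be both `1` and `0`.
  have : (n : ℝ) * (U l₀ l₀ * U l₀ l₀) * (n * (U l₀ l * U l₀ l)) = 0 := by
    linear_combination (n * (U l₀ l₀ * U l₀ l)) * o1
  rw [o2, o3] at this
  norm_num at this

theorem exists_row_ne (hlam : Monotone lam) (hL : DiagonalizedBy N.L U lam) {i j : Fin n}
    (hij : i ≠ j) : ∃ l : Fin n, l.val ≠ 0 ∧ U i l ≠ U j l := by
  by_contra! h
  have hrow : ∀ l, U i l = U j l := by
    intro l
    by_cases hl : l.val = 0
    · exact col_eq_of_eigenvalue_eq_zero hL (eigenvalue_zero_eq_zero hlam hL hl) i j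
    · exact h l hl
  have o1 := hL.sum_row_mul_row i j
  have o2 := hL.sum_row_mul_row j j
  simp only [hrow, if_neg hij, if_pos] at o1 o2
  rw [o1] at o2
  norm_num at o2

end PowerNetwork

/-! ### Long-time limit of the energies and variance of a shifted variable -/

theorem tendsto_lintegral_energy {Φ : ℝ → ℝ} (hΦ : Continuous Φ) :
    Tendsto (fun t => ENNReal.ofReal (∫ s in (0 : ℝ)..t, Φ s ^ 2)) atTop
      (𝓝 (∫⁻ s in Set.Ioi (0 : ℝ), ENNReal.ofReal (Φ s ^ 2))) := by
  have h := (aecover_Iic (μ := volume.restrict (Set.Ioi (0 : ℝ))) (tendsto_id (α := ℝ)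
    (x := atTop))).lintegral_tendsto_of_countably_generated
      (f := fun s => ENNReal.ofReal (Φ s ^ 2)) (by fun_prop)
  refine h.congr' ?_
  filter_upwards [eventually_ge_atTop 0] with t ht
  rw [Measure.restrict_restrict measurableSet_Iic, intervalIntegral.integral_of_le ht,
    ofReal_integral_eq_lintegral_ofReal]
  · congr 2
    ext s
    simp [and_comm]
  · exact (Continuous.integrableOn_Icc (by fun_prop)).mono_set Set.Ioc_subset_Icc_self
  · exact .of_forall fun s => sq_nonneg _

theorem evariance_const_add {Ω : Type*} [MeasurableSpace Ω] {P : Measure Ω}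
    [IsProbabilityMeasure P] {Y : Ω → ℝ} (hY : MemLp Y 2 P) (c : ℝ) :
    evariance (fun x => c + Y x) P = ENNReal.ofReal (variance Y P) := by
  have h : MemLp (fun x => c + Y x) 2 P := (memLp_const c).add hY
  rw [← ofReal_variance h, variance_const_add hY.aestronglyMeasurable]

namespace PowerNetwork

variable {n : ℕ} {N : PowerNetwork n}

theorem d_mul_τ_pos (N : PowerNetwork n) : 0 < N.d * N.τ :=
  mul_pos (div_pos N.β_pos N.J_pos) N.τ_pos

/-! ### The delay-induced limit -/

section SigmaStar

variable {U Q : Matrix (Fin n) (Fin n) ℝ} {lam : Fin n → ℝ}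

theorem specInf_eigenvalue_lt_top (hlam : Monotone lam) (hL : DiagonalizedBy N.L U lam) {l : Fin n}
    (hl : l.val ≠ 0) : specInf (N.d * N.τ) (lam l * N.τ ^ 2) < ∞ :=
  specInf_lt_top N.d_mul_τ_pos (mul_pos (eigenvalue_pos hlam hL hl) (pow_pos N.τ_pos 2))

theorem sum_specInf_eq (hlam : Monotone lam) (hU : DiagonalizedBy N.L U lam)
    (hQ : DiagonalizedBy N.L Q lam) (i j : Fin n) :
    ∑ l : Fin n with l.val ≠ 0, ENNReal.ofReal ((U i l - U j l) ^ 2) *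
        specInf (N.d * N.τ) (lam l * N.τ ^ 2) =
      ∑ l : Fin n with l.val ≠ 0, ENNReal.ofReal ((Q i l - Q j l) ^ 2) *
        specInf (N.d * N.τ) (lam l * N.τ ^ 2) := by
  -- The value `0` at `x = 0` encodes the omission of the first mode, the only one with zero
  -- eigenvalue. At the other eigenvalues `specInf` is finite, so `toReal` loses nothing.
  set φ : ℝ → ℝ := fun x => if x = 0 then 0 else (specInf (N.d * N.τ) (x * N.τ ^ 2)).toReal with hφ
  have hφ0 (x : ℝ) : 0 ≤ φ x := by
    simp only [hφ]
    split_ifs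
    · exact le_rfl
    · exact ENNReal.toReal_nonneg
  have key (R : Matrix (Fin n) (Fin n) ℝ) :
      ∑ l : Fin n with l.val ≠ 0, ENNReal.ofReal ((R i l - R j l) ^ 2) *
        specInf (N.d * N.τ) (lam l * N.τ ^ 2) =
      ENNReal.ofReal (∑ l, (R i l - R j l) ^ 2 * φ (lam l)) := by
    rw [ENNReal.ofReal_sum_of_nonneg fun l _ => mul_nonneg (sq_nonneg _) (hφ0 _),
      Finset.sum_filter]
    refine Finset.sum_congr rfl fun l _ => ?_
    split_ifs with hl
    · have hpos := eigenvalue_pos hlam hU hl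
      rw [ENNReal.ofReal_mul (sq_nonneg _)]
      simp only [hφ, if_neg hpos.ne']
      rw [ENNReal.ofReal_toReal (specInf_eigenvalue_lt_top hlam hU hl).ne]
    · simp [hφ, eigenvalue_zero_eq_zero hlam hU (not_not.1 hl)]
  rw [key, key, hU.sum_sub_sq_mul_eq hQ]

theorem sigmaStar_pos (hn : 2 ≤ n) (hlam : Monotone lam) (hL : DiagonalizedBy N.L U lam)
    (hη : 0 < N.η) : 0 < N.sigmaStar U lam := by
  have hJ := N.J_pos
  have hτ := N.τ_pos
  have hpi := Real.pi_pos
  refine ENNReal.mul_pos (ENNReal.ofReal_pos.2 (by positivity)).ne' (ne_of_gt ?_)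
  have : Nonempty {p : Fin n × Fin n // p.1 ≠ p.2} :=
    ⟨⟨(⟨0, by omega⟩, ⟨1, by omega⟩), by simp [Fin.ext_iff]⟩⟩
  -- The infimum over the finite set of pairs is attained, so positivity for each pair suffices.
  obtain ⟨⟨⟨i, j⟩, hij⟩, hp⟩ := exists_eq_ciInf_of_finite
    (f := fun p : {p : Fin n × Fin n // p.1 ≠ p.2} =>
      (∑ l : Fin n with l.val ≠ 0, ENNReal.ofReal ((U p.1.1 l - U p.1.2 l) ^ 2) *
        specInf (N.d * N.τ) (lam l * N.τ ^ 2)) ^ (1 / 2 : ℝ))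
  rw [← hp]
  obtain ⟨l, hl, hne⟩ := exists_row_ne hlam hL hij
  refine ENNReal.rpow_pos_of_nonneg ?_ (by norm_num)
  refine lt_of_lt_of_le ?_ (Finset.single_le_sum (fun _ _ => zero_le)
    (Finset.mem_filter.2 ⟨Finset.mem_univ l, hl⟩))
  refine ENNReal.mul_pos (ENNReal.ofReal_pos.2 ?_).ne' (specInf_pos _ _).ne'
  have := sub_ne_zero.2 hne
  positivity

theorem sigmaStar_lt_top (hn : 2 ≤ n) (hlam : Monotone lam) (hL : DiagonalizedBy N.L U lam) :
    N.sigmaStar U lam < ∞ := by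
  refine ENNReal.mul_lt_top ENNReal.ofReal_lt_top ?_
  refine (iInf_le _ ⟨(⟨0, by omega⟩, ⟨1, by omega⟩), by simp [Fin.ext_iff]⟩).trans_lt ?_
  refine ENNReal.rpow_lt_top_of_nonneg (by norm_num) (ENNReal.sum_lt_top.2 fun l hl => ?_).ne
  exact ENNReal.mul_lt_top ENNReal.ofReal_lt_top
    (specInf_eigenvalue_lt_top hlam hL (Finset.mem_filter.1 hl).2)

theorem modeWeight_zero (N : PowerNetwork n) (l m k : ℝ) : N.modeWeight 0 l m k =
    ENNReal.ofReal (N.τ ^ 3 * (N.η / N.J) ^ 2) *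
      specFun (N.d * N.τ) (l * N.τ ^ 2) (m * N.τ ^ 2) (k * N.τ) := by
  simp [modeWeight, div_pow]

theorem sigmaStar_le_sigma (hlam : Monotone lam) (hU : DiagonalizedBy N.L U lam)
    (hQ : DiagonalizedBy N.L Q lam) {mu kap : Fin n → ℝ}
    (hreg : ∀ l : Fin n, l.val ≠ 0 →
      InRegion (N.d * N.τ) (lam l * N.τ ^ 2) (mu l * N.τ ^ 2) (kap l * N.τ))
    {i j : Fin n} (hij : i ≠ j) : N.sigmaStar U lam ≤ N.sigma 0 Q lam mu kap i j := by
  have hJ := N.J_pos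
  have hτ := N.τ_pos
  have hη := N.η_nonneg
  have hpi := Real.pi_pos
  set c : ℝ := N.τ ^ (3 / 2 : ℝ) * N.η / (N.J * √(2 * Real.pi)) with hc
  have hc0 : 0 ≤ c := by positivity
  -- This reconciles the prefactor outside the root in `sigmaStar` with the one inside the root in
  -- `sigma`.
  have hc2 : c ^ 2 = 1 / (2 * Real.pi) * (N.τ ^ 3 * (N.η / N.J) ^ 2) := by
    rw [hc, div_pow, mul_pow, mul_pow, Real.sq_sqrt (by positivity), ← Real.rpow_natCast,
      ← Real.rpow_mul hτ.le, show (3 / 2 : ℝ) * ((2 : ℕ) : ℝ) = ((3 : ℕ) : ℝ) by norm_num,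
      Real.rpow_natCast]
    field_simp
  have hcs : ENNReal.ofReal c = ENNReal.ofReal (c ^ 2) ^ (1 / 2 : ℝ) := by
    rw [ENNReal.ofReal_rpow_of_nonneg (sq_nonneg _) (by norm_num), ← Real.sqrt_eq_rpow,
      Real.sqrt_sq hc0]
  calc N.sigmaStar U lam
      ≤ ENNReal.ofReal c * (∑ l : Fin n with l.val ≠ 0, ENNReal.ofReal ((U i l - U j l) ^ 2) *
          specInf (N.d * N.τ) (lam l * N.τ ^ 2)) ^ (1 / 2 : ℝ) :=
        mul_le_mul_right (iInf_le _ (⟨(i, j), hij⟩ : {p : Fin n × Fin n // p.1 ≠ p.2})) _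
    _ = (ENNReal.ofReal (c ^ 2) * ∑ l : Fin n with l.val ≠ 0,
          ENNReal.ofReal ((Q i l - Q j l) ^ 2) *
            specInf (N.d * N.τ) (lam l * N.τ ^ 2)) ^ (1 / 2 : ℝ) := by
        rw [sum_specInf_eq hlam hU hQ, hcs, ENNReal.mul_rpow_of_nonneg _ _ (by norm_num)]
    _ ≤ _ := by
        refine ENNReal.rpow_le_rpow ?_ (by norm_num)
        rw [hc2, ENNReal.ofReal_mul (by positivity), mul_assoc]
        gcongr
        rw [Finset.mul_sum]
        refine Finset.sum_le_sum fun l hl => ?_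
        rw [modeWeight_zero, mul_left_comm]
        gcongr
        exact iInf₂_le_of_le ((mu l * N.τ ^ 2, kap l * N.τ) : ℝ × ℝ)
          (hreg l (Finset.mem_filter.1 hl).2) le_rfl

end SigmaStar

/-! ### The variance of the phase differences -/

section Solution

variable {M K Q : Matrix (Fin n) (Fin n) ℝ} {lam mu kap : Fin n → ℝ}

/-- The modal coordinates of a path of the network satisfy scalar delay equations. -/
theorem exists_modal_representation (hL : DiagonalizedBy N.L Q lam) (hM : DiagonalizedBy M Q mu)
    (hK : DiagonalizedBy K Q kap) (θ₀ ω₀ : ℝ → Fin n → ℝ) {Ψ : ℝ → ℝ} (hΨ : Continuous Ψ)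
    (l : Fin n)
    (hΨe : ∀ t, 0 ≤ t → Ψ t + ∫ r in (0 : ℝ)..t,
      delayKernel N.d (lam l) (mu l) (kap l) N.τ r * Ψ (t - r) = 1) :
    ∃ D : ℝ → ℝ, ∀ (θ ω : ℝ → Fin n → ℝ) (ξ : Fin n → ℝ → ℝ),
      ContinuousOn θ (Set.Ici (-N.τ)) → ContinuousOn ω (Set.Ici (-N.τ)) →
      (∀ m, Continuous (ξ m)) →
      (∀ t ∈ Set.Icc (-N.τ) 0, θ t = θ₀ t ∧ ω t = ω₀ t) →
      (∀ t, 0 ≤ t → ∀ i, θ t i = θ₀ 0 i + ∫ s in (0 : ℝ)..t, ω s i) →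
      (∀ t, 0 ≤ t → ∀ i, ω t i = ω₀ 0 i +
        (∫ s in (0 : ℝ)..t, (-(N.L *ᵥ θ s) i - N.d * ω s i
          - (M *ᵥ θ (s - N.τ)) i - (K *ᵥ ω (s - N.τ)) i)) + N.η / N.J * ξ i t) →
      ∀ t, 0 < t → ∑ m, Q m l * θ t m =
        D t + N.η / N.J * ∫ s in (0 : ℝ)..t, Ψ (t - s) * ∑ m, Q m l * ξ m s := by
  obtain ⟨D, hD⟩ := exists_delay_representation N.d (lam l) (mu l) (kap l) (N.η / N.J) N.τ_pos hΨ hΨe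
    (fun s => ∑ m, Q m l * θ₀ s m) (fun s => ∑ m, Q m l * ω₀ s m)
  refine ⟨D, fun θ ω ξ hθ hω hξ hinit hphase hfreq t ht => ?_⟩
  have hτ := N.τ_pos
  -- The paths are frozen before `-τ` to make them continuous on the whole line, as the scalar
  -- representation demands.
  set θ' : ℝ → Fin n → ℝ := fun s => θ (max s (-N.τ)) with hθ'
  set ω' : ℝ → Fin n → ℝ := fun s => ω (max s (-N.τ)) with hω'
  have hθc : Continuous θ' :=
    hθ.comp_continuous (by fun_prop) fun s => Set.mem_Ici.2 (le_max_right _ _)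
  have hωc : Continuous ω' :=
    hω.comp_continuous (by fun_prop) fun s => Set.mem_Ici.2 (le_max_right _ _)
  have hθe {s : ℝ} (hs : -N.τ ≤ s) : θ' s = θ s := by simp only [hθ', max_eq_left hs]
  have hωe {s : ℝ} (hs : -N.τ ≤ s) : ω' s = ω s := by simp only [hω', max_eq_left hs]
  have hθi (m : Fin n) : Continuous fun s => θ' s m := (continuous_apply m).comp hθc
  have hωi (m : Fin n) : Continuous fun s => ω' s m := (continuous_apply m).comp hωc
  have hmv (A : Matrix (Fin n) (Fin n) ℝ) {y : ℝ → Fin n → ℝ} (hy : ∀ m, Continuous fun s => y s m)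
      (m : Fin n) : Continuous fun s => (A *ᵥ y s) m := by
    simp only [Matrix.mulVec, dotProduct]
    fun_prop
  have hθd (m : Fin n) : Continuous fun s => θ' (s - N.τ) m := (hθi m).comp (by fun_prop)
  have hωd (m : Fin n) : Continuous fun s => ω' (s - N.τ) m := (hωi m).comp (by fun_prop)
  have := hD (fun s => ∑ m, Q m l * θ' s m) (fun s => ∑ m, Q m l * ω' s m)
    (fun s => ∑ m, Q m l * ξ m s) (by fun_prop) (by fun_prop) (by fun_prop) ?_ ?_ ?_ t ht
  · simpa only [hθe (by linarith : -N.τ ≤ t)] using this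
  · intro s hs
    rw [hθe hs.1, hωe hs.1, (hinit s hs).1, (hinit s hs).2]
    exact ⟨rfl, rfl⟩
  · intro r hr
    rw [hθe (by linarith)]
    simp only [hphase r hr, mul_add, Finset.sum_add_distrib]
    rw [intervalIntegral.integral_finsetSum fun m _ =>
      Continuous.intervalIntegrable (by fun_prop) _ _]
    simp only [intervalIntegral.integral_const_mul]
    congr 1
    refine Finset.sum_congr rfl fun m _ => ?_
    congr 1
    refine intervalIntegral.integral_congr fun s hs => ?_
    rw [Set.uIcc_of_le hr] at hs
    simp only [hωe (by linarith [hs.1] : -N.τ ≤ s)]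
  · intro r hr
    rw [hωe (by linarith)]
    have hint (m : Fin n) : ∫ s in (0 : ℝ)..r, (-(N.L *ᵥ θ s) m - N.d * ω s m
          - (M *ᵥ θ (s - N.τ)) m - (K *ᵥ ω (s - N.τ)) m) =
        ∫ s in (0 : ℝ)..r, (-(N.L *ᵥ θ' s) m - N.d * ω' s m
          - (M *ᵥ θ' (s - N.τ)) m - (K *ᵥ ω' (s - N.τ)) m) := by
      refine intervalIntegral.integral_congr fun s hs => ?_
      rw [Set.uIcc_of_le hr] at hs
      simp only [hωe (by linarith [hs.1] : -N.τ ≤ s), hθe (by linarith [hs.1] : -N.τ ≤ s),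
        hωe (by linarith [hs.1] : -N.τ ≤ s - N.τ), hθe (by linarith [hs.1] : -N.τ ≤ s - N.τ)]
    have c1 := hmv N.L hθi
    have c2 := hmv M hθd
    have c3 := hmv K hωd
    have e (s : ℝ) : -(lam l * ∑ m, Q m l * θ' s m) - N.d * (∑ m, Q m l * ω' s m) -
        mu l * (∑ m, Q m l * θ' (s - N.τ) m) - kap l * (∑ m, Q m l * ω' (s - N.τ) m) =
        ∑ m, Q m l * (-(N.L *ᵥ θ' s) m - N.d * ω' s m
          - (M *ᵥ θ' (s - N.τ)) m - (K *ᵥ ω' (s - N.τ)) m) := by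
      rw [← hL.sum_col_mul_mulVec, ← hM.sum_col_mul_mulVec, ← hK.sum_col_mul_mulVec, Finset.mul_sum,
        ← Finset.sum_neg_distrib, ← Finset.sum_sub_distrib, ← Finset.sum_sub_distrib,
        ← Finset.sum_sub_distrib]
      exact Finset.sum_congr rfl fun m _ => by ring
    simp only [e, hfreq r hr, hint, mul_add, Finset.sum_add_distrib]
    rw [intervalIntegral.integral_finsetSum fun m _ =>
      Continuous.intervalIntegrable (by fun_prop) _ _]
    simp only [intervalIntegral.integral_const_mul]
    congr 1
    rw [Finset.mul_sum]
    exact Finset.sum_congr rfl fun m _ => by ring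

/-- The variance is an explicit sum of nondecreasing energies, so its lower limit is a limit, and
each energy dominates its spectral integral. Stability plays no role: a mode of infinite energy only
helps. -/
theorem sigma_le_steadyStd (hL : DiagonalizedBy N.L Q lam) (hM : DiagonalizedBy M Q mu)
    (hK : DiagonalizedBy K Q kap) {Ω : Type*} [MeasurableSpace Ω] (P : Measure Ω)
    [IsProbabilityMeasure P] {ξ : Fin 3 → Fin n → ℝ≥0 → Ω → ℝ} {θ₀ ω₀ : ℝ → Fin n → ℝ}
    {θ ω : ℝ → Ω → Fin n → ℝ} (hsol : N.IsSolution M K 0 P ξ θ₀ ω₀ θ ω) (i j : Fin n) :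
    N.sigma 0 Q lam mu kap i j ≤ steadyStd P θ i j := by
  have hτ := N.τ_pos
  have hpi := Real.pi_pos
  have hex (l : Fin n) := exists_volterra_solution
    (measurable_delayKernel N.d (lam l) (mu l) (kap l) N.τ)
    (abs_delayKernel_le N.d (lam l) (mu l) (kap l) hτ.le)
  choose Ψ hΨc hΨe using hex
  -- `D` is chosen before the sample point, so it is deterministic and drops out of the variance.
  choose D hD using fun l => exists_modal_representation hL hM hK θ₀ ω₀ (hΨc l) l (hΨe l)
  obtain ⟨hbrown, hindep, -, -, -, -, hpath, hinit, hphase, hfreq⟩ := hsol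
  have hξ : ∀ m, IsBrownianReal (ξ 0 m) P := hbrown 0
  have hind : iIndepFun (fun m x (t : ℝ≥0) => ξ 0 m t x) P :=
    hindep.precomp (g := fun m : Fin n => ((0 : Fin 3), m)) fun m m' h => (Prod.ext_iff.1 h).2
  have hrep : ∀ᵐ x ∂P, ∀ t, 0 < t → ∀ l, ∑ m, Q m l * θ t x m =
      D l t + N.η / N.J * ∫ s in (0 : ℝ)..t, Ψ l (t - s) * modalNoise Q (ξ 0) l s x := by
    have hcont : ∀ᵐ x ∂P, ∀ m, Continuous fun t => ξ 0 m t x := ae_all_iff.2 fun m => (hξ m).cont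
    filter_upwards [hpath, hinit, hphase, hfreq, hcont]
      with x h1 h2 h3 h4 h5 t ht l
    exact hD l (fun t => θ t x) (fun t => ω t x) (fun m t => ξ 0 m t.toNNReal x) h1.1 h1.2
      (fun m => (h5 m).comp continuous_real_toNNReal) h2 h3
      (fun t ht i => by simpa using h4 t ht i) t ht
  set Φ : Fin n → ℝ → ℝ := fun l t => ∫ s in (0 : ℝ)..t, Ψ l s with hΦ
  have hΦc (l : Fin n) : Continuous (Φ l) :=
    intervalIntegral.continuous_primitive (fun _ _ => (hΨc l).intervalIntegrable _ _) 0
  set a : Fin n → ℝ := fun l => N.η / N.J * (Q i l - Q j l) with ha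
  have hvar {t : ℝ} (ht : 0 < t) : evariance (fun x => θ t x i - θ t x j) P =
      ∑ l, ENNReal.ofReal (a l ^ 2) * ENNReal.ofReal (∫ s in (0 : ℝ)..t, Φ l s ^ 2) := by
    obtain ⟨hmem, hv⟩ := memLp_and_variance_modal_integral hL.1 hξ hind hΨc a ht.le
    have hae : (fun x => θ t x i - θ t x j) =ᵐ[P] fun x => (∑ l, (Q i l - Q j l) * D l t) +
        ∑ l, a l * ∫ s in (0 : ℝ)..t, Ψ l (t - s) * modalNoise Q (ξ 0) l s x := by
      filter_upwards [hrep] with x hx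
      rw [hL.sum_row_mul_modal (θ t x) i, hL.sum_row_mul_modal (θ t x) j, ← Finset.sum_sub_distrib,
        ← Finset.sum_add_distrib]
      refine Finset.sum_congr rfl fun l _ => ?_
      rw [hx t ht l, ha]
      ring
    have hI (l : Fin n) : 0 ≤ ∫ s in (0 : ℝ)..t, Φ l s ^ 2 :=
      intervalIntegral.integral_nonneg ht.le fun s _ => sq_nonneg _
    rw [evariance_congr hae, evariance_const_add hmem, hv,
      ENNReal.ofReal_sum_of_nonneg fun l _ => mul_nonneg (sq_nonneg _) (hI l)]
    exact Finset.sum_congr rfl fun l _ => ENNReal.ofReal_mul (sq_nonneg _)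
  have hlim : Tendsto (fun t => evariance (fun x => θ t x i - θ t x j) P) atTop
      (𝓝 (∑ l, ENNReal.ofReal (a l ^ 2) *
        ∫⁻ s in Set.Ioi (0 : ℝ), ENNReal.ofReal (Φ l s ^ 2))) := by
    refine (tendsto_finsetSum _ fun l _ => ENNReal.Tendsto.const_mul
      (tendsto_lintegral_energy (hΦc l)) (.inr ENNReal.ofReal_ne_top)).congr' ?_
    filter_upwards [eventually_gt_atTop 0] with t ht using (hvar ht).symm
  unfold sigma steadyStd
  rw [hlim.liminf_eq]
  refine ENNReal.rpow_le_rpow ?_ (by norm_num)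
  rw [Finset.mul_sum]
  -- The limit variance runs over all modes, while `sigma` omits the first. The extra term is
  -- nonnegative.
  refine (Finset.sum_le_sum fun l _ => ?_).trans
    (Finset.sum_le_sum_of_subset (Finset.filter_subset _ _))
  have hen := specFun_le_energy N.d (lam l) (mu l) (kap l) hτ (hΦc l) fun t ht =>
    primitive_volterra (measurable_delayKernel N.d (lam l) (mu l) (kap l) N.τ)
      (abs_delayKernel_le N.d (lam l) (mu l) (kap l) hτ.le) (hΨc l) (hΨe l) ht
  refine le_trans (le_of_eq ?_) (mul_le_mul_right hen _)
  rw [modeWeight_zero, ← mul_assoc, ← mul_assoc, ← mul_assoc, ← ENNReal.ofReal_mul (by positivity),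
    ← ENNReal.ofReal_mul (by positivity), ← ENNReal.ofReal_mul (by positivity), ha]
  congr 2
  ring

end Solution

end PowerNetwork

end PowerRisk

theorem mainTheorem8 {n : ℕ} (hn : 2 ≤ n) (N : PowerRisk.PowerNetwork n)
    (U : Matrix (Fin n) (Fin n) ℝ) (lam : Fin n → ℝ) (hlam : Monotone lam)
    (hL : PowerRisk.DiagonalizedBy N.L U lam) :
    (∀ l : Fin n, l.val ≠ 0 →
      0 < PowerRisk.specInf (N.d * N.τ) (lam l * N.τ ^ 2) ∧
        PowerRisk.specInf (N.d * N.τ) (lam l * N.τ ^ 2) < ∞) ∧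
    (0 < N.η → 0 < N.sigmaStar U lam) ∧ N.sigmaStar U lam < ∞ ∧
    ∀ (M K Q : Matrix (Fin n) (Fin n) ℝ) (mu kap : Fin n → ℝ),
      PowerRisk.DiagonalizedBy N.L Q lam →
      PowerRisk.DiagonalizedBy M Q mu →
      PowerRisk.DiagonalizedBy K Q kap →
      (∀ l : Fin n, l.val ≠ 0 →
        PowerRisk.InRegion (N.d * N.τ) (lam l * N.τ ^ 2) (mu l * N.τ ^ 2) (kap l * N.τ)) →
      ∀ i j : Fin n, i ≠ j →
        N.sigmaStar U lam ≤ N.sigma 0 Q lam mu kap i j ∧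
        ∀ {Ω : Type*} [MeasurableSpace Ω] (P : Measure Ω) [IsProbabilityMeasure P]
          (ξ : Fin 3 → Fin n → ℝ≥0 → Ω → ℝ) (θ₀ ω₀ : ℝ → Fin n → ℝ)
          (θ ω : ℝ → Ω → Fin n → ℝ),
          N.IsSolution M K 0 P ξ θ₀ ω₀ θ ω →
            N.sigmaStar U lam ≤ PowerRisk.steadyStd P θ i j := by
  refine ⟨fun l hl => ⟨PowerRisk.specInf_pos _ _,
    PowerRisk.PowerNetwork.specInf_eigenvalue_lt_top hlam hL hl⟩,
    PowerRisk.PowerNetwork.sigmaStar_pos hn hlam hL,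
    PowerRisk.PowerNetwork.sigmaStar_lt_top hn hlam hL, ?_⟩
  intro M K Q mu kap hLQ hM hK hreg i j hij
  have hle := PowerRisk.PowerNetwork.sigmaStar_le_sigma hlam hL hLQ hreg hij
  refine ⟨hle, ?_⟩
  intro Ω _ P _ ξ θ₀ ω₀ θ ω hsol
  exact hle.trans (PowerRisk.PowerNetwork.sigma_le_steadyStd hLQ hM hK P hsol i j)
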